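/- A computer is a partial recursive function $C:\{0,1\}^*\to\{0,1\}^*$ whose domain is prefix-free. A computer $U$ is optimal if for every computer $C$ there is a constant $c$ such that, whenever $C(p)$ is defined, there is $p'$ with $U(p')=C(p)$ and $|p'|\le|p|+c$. Fix an optimal computer $U$, let $H(s)=\min\{|p| : U(p)=s\}$, and let $q_1,q_2,q_3,\dots$ be any enumeration without repetition (not necessarily recursive) of $\operatorname{Dom}U$. For $T>0$ and $n\ge 1$ put $$Z_n(T)=\sum_{i=1}^n 2^{-|q_i|/T},\qquad E_n(T)=\frac1{Z_n(T)}\sum_{i=1}^n |q_i|\,2^{-|q_i|/T},\qquad C_n(T)=E_n'(T),$$ and $E(T)=\lim_{n\to\infty}E_n(T)$, $C(T)=\lim_{n\to\infty}C_n(T)$. A real $x$ is computable if there is a total recursive $f:\mathbb N^+\to\mathbb Q$ with $|x-f(n)|<1/n$ for all $n\ge1$; it is left-computable if there is a total recursive $g:\mathbb N^+\to\mathbb Q$ with $g(n)\le x$ for all $n\ge 1$ and $\lim_n g(n)=x$. Let $x_n$ be the first $n$ bits of the base-two expansion, with infinitely many zeros, of $x-\lfloor x\rfloor$. For $D\ge0$,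 $x$ is Chaitin $D$-random if $\lim_{n\to\infty}(H(x_n)-Dn)=\infty$, and $D$-compressible if $H(x_n)\le Dn+o(n)$. **Theorem 4.5.** Let $T\in\mathbb R$; the functions $E_n$ are differentiable on $(0,\infty)$. (i) If $0<T<1$ and $T$ is computable, then $C_n(T)$ converges to a real number $C(T)$ that is left-computable, Chaitin $T$-random and $T$-compressible. Moreover, $E_n(t)$ converges to $E(t)$ for every $t\in(0,1)$, $E$ is differentiable at $T$, and $C(T)=E'(T)$. (ii) If $T=1$, then $C_n(T)\to\infty$ as $n\to\infty$. -/

import Mathlib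

open Filter Topology

namespace AIT

/-! ### Computers and program-size complexity -/

/-- A computer: a partial recursive function on finite binary strings with prefix-free domain. -/
def IsComputer (C : List Bool →. List Bool) : Prop :=
  Partrec C ∧ ∀ p ∈ C.Dom, ∀ p' ∈ C.Dom, p <+: p' → p = p'

/-- An optimal computer: it simulates every computer with a constant overhead in program length. -/
def IsOptimal (U : List Bool →. List Bool) : Prop :=
  IsComputer U ∧
    ∀ C : List Bool →. List Bool, IsComputer C →
      ∃ sim : ℕ, ∀ p s : List Bool, s ∈ C p →
        ∃ p' : List Bool, s ∈ U p' ∧ p'.length ≤ p.length + sim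

/-- The program-size complexity `H(s)`: the least length of a program `p` with `U(p) = s`.
(Such a program exists for every `s` when `U` is optimal.) -/
noncomputable def complexity (U : List Bool →. List Bool) (s : List Bool) : ℕ :=
  sInf {l : ℕ | ∃ p : List Bool, s ∈ U p ∧ p.length = l}

/-! ### Computability of real numbers -/

/-- A total recursive function to the rationals, given by recursive numerator (as a difference of
natural numbers) and denominator. -/
def IsRecursiveRat (f : ℕ → ℚ) : Prop :=
  ∃ a b c : ℕ → ℕ, Computable a ∧ Computable b ∧ Computable c ∧
    ∀ n, f n = ((a n : ℚ) - (b n : ℚ)) / ((c n : ℚ) + 1)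

/-- Computable real numbers. -/
def IsComputableReal (x : ℝ) : Prop :=
  ∃ f : ℕ → ℚ, IsRecursiveRat f ∧ ∀ n : ℕ, 0 < n → |x - (f n : ℝ)| < 1 / (n : ℝ)

/-- Right-computable real numbers. -/
def IsRightComputable (x : ℝ) : Prop :=
  ∃ g : ℕ → ℚ, IsRecursiveRat g ∧ (∀ n : ℕ, 0 < n → x ≤ (g n : ℝ)) ∧
    Tendsto (fun n => (g n : ℝ)) atTop (𝓝 x)

/-- Left-computable real numbers. -/
def IsLeftComputable (x : ℝ) : Prop :=
  IsRightComputable (-x)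

/-! ### Randomness and compressibility of real numbers -/

/-- The first `n` bits of the base-two expansion with infinitely many zeros of `x mod 1`. -/
noncomputable def firstBits (x : ℝ) (n : ℕ) : List Bool :=
  (List.range n).map fun i => decide (⌊Int.fract x * 2 ^ (i + 1)⌋ % 2 = 1)

/-- Chaitin `D`-randomness (with respect to `U`) of a real number. -/
def IsChaitinRandom (U : List Bool →. List Bool) (D x : ℝ) : Prop :=
  Tendsto (fun n : ℕ => (complexity U (firstBits x n) : ℝ) - D * n) atTop atTop

/-- `D`-compressibility (with respect to `U`) of a real number: `H(x_n) ≤ D n + o(n)`. -/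
def IsCompressible (U : List Bool →. List Bool) (D x : ℝ) : Prop :=
  ∃ g : ℕ → ℝ, Tendsto (fun n : ℕ => g n / n) atTop (𝓝 0) ∧
    ∀ n : ℕ, 0 < n → (complexity U (firstBits x n) : ℝ) ≤ D * n + g n

/-! ### Thermodynamic quantities

The sequence `q 0, q 1, q 2, …` is an enumeration of the domain of the optimal computer. -/

/-- `Z_n(T)`, the sum of `2 ^ (-|p| / T)` over the first `n` programs `p`. -/
noncomputable def partitionN (q : ℕ → List Bool) (n : ℕ) (T : ℝ) : ℝ :=
  ∑ i ∈ Finset.range n, (2 : ℝ) ^ (-((q i).length : ℝ) / T)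

/-- `E_n(T)`. -/
noncomputable def energyN (q : ℕ → List Bool) (n : ℕ) (T : ℝ) : ℝ :=
  1 / partitionN q n T *
    ∑ i ∈ Finset.range n, ((q i).length : ℝ) * (2 : ℝ) ^ (-((q i).length : ℝ) / T)

/-- The energy `E(T) = lim E_n(T)`. -/
noncomputable def energy (q : ℕ → List Bool) (T : ℝ) : ℝ :=
  limUnder atTop fun n => energyN q n T

/-- `C_n(T) = E_n'(T)`. -/
noncomputable def specificHeatN (q : ℕ → List Bool) (n : ℕ) (T : ℝ) : ℝ :=
  deriv (energyN q n) T

/-- The specific heat `C(T) = lim C_n(T)`. -/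
noncomputable def specificHeat (q : ℕ → List Bool) (T : ℝ) : ℝ :=
  limUnder atTop fun n => specificHeatN q n T

end AIT

/-! Differentiating `2 ^ (-|p| / T)` in `T` multiplies it by `log 2 / T ^ 2 * |p|`, so `C_n(T)` is
`log 2 / T ^ 2` times the variance of the program length under these weights. Kraft's inequality
makes the weights summable at `T = 1`. For `0 < T < 1` all moments therefore converge absolutely,
the limits do not depend on the order of enumeration, and local domination allows differentiation
under the sum. This gives convergence and `C = E'`.

The main estimate is `exists_finVar_bounds`. Once a finite set `F` of programs contains the short
ones, the error `C(T) - heat(F)` lies between two positive multiples of the tail `R(F)`, the sum of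
`|p| ^ 2 * 2 ^ (-|p| / T)` over `p` outside `F`. Taking for `F` the programs that halt within `t`
steps gives sets that are computable although `q` need not be. Their heats can be compared
effectively with rationals and tend to `C(T)` from below, whence left-computability.

Randomness (`exists_short_program`): the first `n` bits of `C(T)` lead to a stage with error below
`2 / 2 ^ n`, hence to a string that no program of that stage outputs. A program for this string,
only `O(1)` longer than `H(x_n)`, lies in the tail, so its length `L` satisfies `L ^ 2 * 2 ^ (-L /
T) = O(2 ^ (-n))`. The factor `L ^ 2` gives `L - T * n` at least `2 * T * log L - O(1)`, which is
unbounded.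

Compressibility (`exists_compressor`): about `T * n` bits of the halting probability identify a
stage whose tail in `2 ^ (-|p|)` is so small that `R` is below `2 ^ (-n)` up to a constant; its heat
then yields `n` bits of `C(T)` up to a bounded correction.

At `T = 1` the mean length diverges (`not_summable_length`) while the total weight stays bounded, so
a single fixed program forces the variance to infinity. -/

namespace AIT

/-! ### Weighted variances -/

section Variance

variable {y w : ℕ → ℝ}

/-- Variance of `y` over the finite set `F` with weights `w`. -/
noncomputable def finVar (y w : ℕ → ℝ) (F : Finset ℕ) : ℝ :=
  ((∑ i ∈ F, y i ^ 2 * w i) * (∑ i ∈ F, w i) - (∑ i ∈ F, y i * w i) ^ 2) / (∑ i ∈ F, w i) ^ 2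

/-- Variance of `y` with weights `w`. -/
noncomputable def totalVar (y w : ℕ → ℝ) : ℝ :=
  ((∑' i, y i ^ 2 * w i) * (∑' i, w i) - (∑' i, y i * w i) ^ 2) / (∑' i, w i) ^ 2

theorem sq_sum_le (hw : ∀ i, 0 ≤ w i) (F : Finset ℕ) :
    (∑ i ∈ F, y i * w i) ^ 2 ≤ (∑ i ∈ F, y i ^ 2 * w i) * (∑ i ∈ F, w i) := by
  have h := Finset.sum_mul_sq_le_sq_mul_sq F (fun i => y i * √(w i)) (fun i => √(w i))
  have e1 : ∀ i, y i * √(w i) * √(w i) = y i * w i := fun i => by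
    rw [mul_assoc, Real.mul_self_sqrt (hw i)]
  have e2 : ∀ i, (y i * √(w i)) ^ 2 = y i ^ 2 * w i := fun i => by
    rw [mul_pow, Real.sq_sqrt (hw i)]
  simpa only [e1, e2, Real.sq_sqrt (hw _)] using h

theorem finVar_nonneg (hw : ∀ i, 0 ≤ w i) (F : Finset ℕ) : 0 ≤ finVar y w F :=
  div_nonneg (sub_nonneg.2 (sq_sum_le hw F)) (sq_nonneg _)

/-- Here `s` and `r` are the moments of the head and of the tail. Split the second moment about the
full mean `m`: the head contributes at least `s0 * v` by the parallel axis identity. The term `K *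
r0` in `hr` pays for the growth of the normalising weight from `s0` to `s0 + r0`. -/
theorem totalVar_lower {s0 s1 s2 r0 r1 r2 m K v V : ℝ} (hs0 : 0 < s0) (hr0 : 0 ≤ r0)
    (hm : m = (s1 + r1) / (s0 + r0)) (hv : v = (s2 * s0 - s1 ^ 2) / s0 ^ 2)
    (hV : V = ((s2 + r2) * (s0 + r0) - (s1 + r1) ^ 2) / (s0 + r0) ^ 2) (hK : v ≤ K)
    (hr : r2 / 4 ≤ r2 - 2 * m * r1 + m ^ 2 * r0 - K * r0) :
    v + 1 / (4 * (s0 + r0)) * r2 ≤ V := by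
  have hZ : 0 < s0 + r0 := by linarith
  have h1 : (s0 + r0) * V = (s2 - 2 * m * s1 + m ^ 2 * s0) + (r2 - 2 * m * r1 + m ^ 2 * r0) := by
    rw [hV, hm]; field_simp; ring
  have h2 : s2 - 2 * m * s1 + m ^ 2 * s0 = s0 * v + s0 * (m - s1 / s0) ^ 2 := by
    rw [hv]; field_simp; ring
  have h3 : 0 ≤ s0 * (m - s1 / s0) ^ 2 := by positivity
  have h4 : v * r0 ≤ K * r0 := mul_le_mul_of_nonneg_right hK hr0
  have h5 : (s0 + r0) * (v + 1 / (4 * (s0 + r0)) * r2) ≤ (s0 + r0) * V := by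
    have : (s0 + r0) * (v + 1 / (4 * (s0 + r0)) * r2) = s0 * v + v * r0 + r2 / 4 := by
      field_simp
    rw [this, h1, h2]; linarith
  exact le_of_mul_le_mul_left h5 hZ

/-- The variance is at most the second moment about any point; the mean of the head is used, which
reduces the head to exactly `s0 * v`. -/
theorem totalVar_upper {s0 s1 s2 r0 r1 r2 M v V : ℝ} (hs0 : 0 < s0) (hs1 : 0 ≤ s1) (hr0 : 0 ≤ r0)
    (hr1 : 0 ≤ r1) (hM : s1 / s0 ≤ M) (hv : v = (s2 * s0 - s1 ^ 2) / s0 ^ 2) (hv0 : 0 ≤ v)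
    (hV : V = ((s2 + r2) * (s0 + r0) - (s1 + r1) ^ 2) / (s0 + r0) ^ 2) (hr : r0 ≤ r2) :
    V ≤ v + (1 + M ^ 2) / (s0 + r0) * r2 := by
  have hZ : 0 < s0 + r0 := by linarith
  set m := s1 / s0 with hm
  have hm0 : 0 ≤ m := by positivity
  have h1 : (s0 + r0) * V = (s2 - 2 * m * s1 + m ^ 2 * s0) + (r2 - 2 * m * r1 + m ^ 2 * r0)
      - (s0 + r0) * (m - (s1 + r1) / (s0 + r0)) ^ 2 := by
    rw [hV]; field_simp; ring
  have h2 : s2 - 2 * m * s1 + m ^ 2 * s0 = s0 * v := by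
    rw [hv, hm]; field_simp; ring
  have h3 : 0 ≤ (s0 + r0) * (m - (s1 + r1) / (s0 + r0)) ^ 2 := by positivity
  have h4 : m ^ 2 * r0 ≤ M ^ 2 * r2 := by gcongr
  have h5 : 0 ≤ m * r1 := by positivity
  have h6 : 0 ≤ v * r0 := by positivity
  have h7 : (s0 + r0) * V ≤ (s0 + r0) * (v + (1 + M ^ 2) / (s0 + r0) * r2) := by
    have : (s0 + r0) * (v + (1 + M ^ 2) / (s0 + r0) * r2) = s0 * v + v * r0 + r2 + M ^ 2 * r2 := by
      field_simp
      ring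
    rw [this, h1, h2]; linarith
  exact le_of_mul_le_mul_left h7 hZ

/-- Adding outliers increases the variance, by an amount comparable to their second moment. -/
theorem exists_finVar_bounds (hw : ∀ i, 0 < w i) (hy : ∀ i, 0 ≤ y i) (hlim : Tendsto y cofinite atTop)
    (h0 : Summable w) (h1 : Summable fun i => y i * w i) (h2 : Summable fun i => y i ^ 2 * w i) :
    ∃ (B : Finset ℕ) (c C : ℝ), B.Nonempty ∧ 0 < c ∧ 0 < C ∧ (∀ i ∉ B, 1 ≤ y i) ∧
      ∀ F : Finset ℕ, B ⊆ F →
        finVar y w F + c * (∑' i : {i // i ∉ F}, y i ^ 2 * w i) ≤ totalVar y w ∧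
        totalVar y w ≤ finVar y w F + C * (∑' i : {i // i ∉ F}, y i ^ 2 * w i) := by
  set Z := ∑' i, w i with hZ
  set t1 := ∑' i, y i * w i with ht1
  set t2 := ∑' i, y i ^ 2 * w i with ht2
  have hwnn : ∀ i, 0 ≤ w i := fun i => (hw i).le
  have hZ0 : 0 < Z := h0.tsum_pos hwnn 0 (hw 0)
  set m := t1 / Z with hm
  -- Every `F` containing the index `0` has weight at least `w 0`, so `t2 / w 0` bounds its variance
  -- and `t1 / w 0` its mean, uniformly in `F`.
  set K := t2 / w 0 with hK
  have hev : ∀ᶠ i in cofinite, y i ^ 2 / 4 ≤ (y i - m) ^ 2 - K ∧ 1 ≤ y i := by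
    have : ∀ᶠ z : ℝ in atTop, z ^ 2 / 4 ≤ (z - m) ^ 2 - K ∧ 1 ≤ z := by
      filter_upwards [eventually_ge_atTop (4 * |m| + |K| + 2)] with z hz
      have hm0 := abs_nonneg m
      have hk0 := abs_nonneg K
      have h1 := le_abs_self K
      refine ⟨?_, by linarith⟩
      have h2 : z * m ≤ z * |m| := mul_le_mul_of_nonneg_left (le_abs_self m) (by linarith)
      have h3 : z * (4 * |m|) ≤ z * z := mul_le_mul_of_nonneg_left (by linarith) (by linarith)
      have h4 : (|K| + 2) * (|K| + 2) ≤ z * z :=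
        mul_le_mul (by linarith) (by linarith) (by linarith) (by linarith)
      nlinarith [sq_nonneg m, sq_nonneg K, sq_nonneg |K|]
    exact hlim.eventually this
  set B : Finset ℕ := insert 0 hev.toFinset with hB
  have hBmem : ∀ i ∉ B, y i ^ 2 / 4 ≤ (y i - m) ^ 2 - K ∧ 1 ≤ y i := by
    intro i hi
    by_contra hcon
    exact hi (Finset.mem_insert_of_mem ((Set.Finite.mem_toFinset _).2 hcon))
  refine ⟨B, 1 / (4 * Z), (1 + (t1 / w 0) ^ 2) / Z, ⟨0, by simp [hB]⟩, by positivity, by positivity,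
    fun i hi => (hBmem i hi).2, fun F hF => ?_⟩
  have h0F : 0 ∈ F := hF (by simp [hB])
  have hs0 : w 0 ≤ ∑ i ∈ F, w i := Finset.single_le_sum (fun i _ => hwnn i) h0F
  have hw0 := hw 0
  have e0 : ∑ i ∈ F, w i + ∑' i : {i // i ∉ F}, w i = Z := h0.sum_add_tsum_subtype_compl F
  have e1 : ∑ i ∈ F, y i * w i + ∑' i : {i // i ∉ F}, y i * w i = t1 :=
    h1.sum_add_tsum_subtype_compl F
  have e2 : ∑ i ∈ F, y i ^ 2 * w i + ∑' i : {i // i ∉ F}, y i ^ 2 * w i = t2 :=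
    h2.sum_add_tsum_subtype_compl F
  have g0 : Summable fun i : {i // i ∉ F} => w i := h0.subtype _
  have g1 : Summable fun i : {i // i ∉ F} => y i * w i := h1.subtype _
  have g2 : Summable fun i : {i // i ∉ F} => y i ^ 2 * w i := h2.subtype _
  have hv0 : 0 ≤ finVar y w F := finVar_nonneg hwnn F
  have hv := finVar.eq_1 y w F
  have hV := totalVar.eq_1 y w
  rw [← hZ, ← ht1, ← ht2, ← e0, ← e1, ← e2] at hV
  have hr0 : 0 ≤ ∑' i : {i // i ∉ F}, w i := tsum_nonneg fun i => hwnn _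
  have hr1 : 0 ≤ ∑' i : {i // i ∉ F}, y i * w i := tsum_nonneg fun i => mul_nonneg (hy _) (hwnn _)
  have hr2 : 0 ≤ ∑' i : {i // i ∉ F}, y i ^ 2 * w i :=
    tsum_nonneg fun i => mul_nonneg (sq_nonneg _) (hwnn _)
  have hs1 : 0 ≤ ∑ i ∈ F, y i * w i := Finset.sum_nonneg fun i _ => mul_nonneg (hy _) (hwnn _)
  have hs2 : 0 ≤ ∑ i ∈ F, y i ^ 2 * w i :=
    Finset.sum_nonneg fun i _ => mul_nonneg (sq_nonneg _) (hwnn _)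
  constructor
  · rw [← e0]
    refine totalVar_lower (K := K) (by linarith) hr0 (m := m) ?_ hv hV ?_ ?_
    · rw [e0, e1]
    · calc finVar y w F ≤ ((∑ i ∈ F, y i ^ 2 * w i) * (∑ i ∈ F, w i)) / (∑ i ∈ F, w i) ^ 2 := by
            rw [finVar]; gcongr; nlinarith [sq_nonneg (∑ i ∈ F, y i * w i)]
        _ = (∑ i ∈ F, y i ^ 2 * w i) / (∑ i ∈ F, w i) := by
            have : 0 < ∑ i ∈ F, w i := by linarith
            field_simp
        _ ≤ t2 / w 0 := by
            have : 0 ≤ t2 := by linarith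
            gcongr
            linarith
    · have hsum := g2.div_const 4
      rw [← tsum_div_const, ← g1.tsum_mul_left (2 * m), ← g2.tsum_sub (g1.mul_left _),
        ← g0.tsum_mul_left (m ^ 2), ← (g2.sub (g1.mul_left _)).tsum_add (g0.mul_left _),
        ← g0.tsum_mul_left K,
        ← ((g2.sub (g1.mul_left _)).add (g0.mul_left _)).tsum_sub (g0.mul_left _)]
      refine hsum.tsum_le_tsum (fun i => ?_)
        (((g2.sub (g1.mul_left _)).add (g0.mul_left _)).sub (g0.mul_left _))
      have := mul_le_mul_of_nonneg_right (hBmem i (fun h => i.2 (hF h))).1 (hwnn i)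
      linarith
  · rw [← e0]
    refine totalVar_upper (by linarith) hs1 hr0 hr1 ?_ hv hv0 hV ?_
    · have : 0 ≤ t1 := by linarith
      gcongr
      linarith
    · refine g0.tsum_le_tsum (fun i => ?_) g2
      have := (hBmem i (fun h => i.2 (hF h))).2
      exact le_mul_of_one_le_left (hwnn _) (one_le_pow₀ this)

theorem tendsto_finVar {ι : Type*} {l : Filter ι} {F : ι → Finset ℕ} (hF : Tendsto F l atTop)
    (hw : ∀ i, 0 < w i)
    (h0 : Summable w) (h1 : Summable fun i => y i * w i) (h2 : Summable fun i => y i ^ 2 * w i) :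
    Tendsto (fun n => finVar y w (F n)) l (𝓝 (totalVar y w)) := by
  have hZ0 : 0 < ∑' i, w i := h0.tsum_pos (fun i => (hw i).le) 0 (hw 0)
  exact (((h2.hasSum.comp hF).mul (h0.hasSum.comp hF)).sub ((h1.hasSum.comp hF).pow 2)).div
    ((h0.hasSum.comp hF).pow 2) (by positivity)

end Variance

/-! ### Kraft's inequality -/

/-- The first codewords of two factorisations are prefixes of the same string, hence comparable,
hence equal; they can then be cancelled. The empty word could be inserted anywhere, so it must be
excluded. -/
theorem uniquelyDecodable_of_prefixFree {S : Set (List Bool)} (hnil : [] ∉ S)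
    (hS : ∀ p ∈ S, ∀ p' ∈ S, p <+: p' → p = p') : InformationTheory.UniquelyDecodable S := by
  intro L₁
  induction L₁ with
  | nil =>
    rintro (_ | ⟨b, L⟩) _ h2 he
    · rfl
    · have : b = [] := by simp at he; exact he.1
      exact absurd (this ▸ h2 b (by simp)) hnil
  | cons a L ih =>
    rintro (_ | ⟨b, L'⟩) h1 h2 he
    · have : a = [] := by simp at he; exact he.1
      exact absurd (this ▸ h1 a (by simp)) hnil
    · simp only [List.flatten_cons] at he
      have ha := h1 a (by simp)
      have hb := h2 b (by simp)
      have hab : a = b := by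
        rcases List.prefix_or_prefix_of_prefix (List.prefix_append a L.flatten)
          (he ▸ List.prefix_append b L'.flatten) with h | h
        · exact hS a ha b hb h
        · exact (hS b hb a ha h).symm
      subst hab
      rw [ih L' (fun w hw => h1 w (by simp [hw])) (fun w hw => h2 w (by simp [hw]))
        (List.append_cancel_left he)]

theorem sum_half_pow_length_le_one {S : Set (List Bool)}
    (hS : ∀ p ∈ S, ∀ p' ∈ S, p <+: p' → p = p') {q : ℕ → List Bool} (hq : Function.Injective q)
    (hqS : ∀ i, q i ∈ S) (F : Finset ℕ) : ∑ i ∈ F, (1 / 2 : ℝ) ^ (q i).length ≤ 1 := by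
  -- A prefix-free set containing the empty word has no other element, whereas `q` takes two
  -- distinct values.
  have hnil : [] ∉ S := fun h =>
    zero_ne_one (hq ((hS [] h _ (hqS 0) List.nil_prefix).symm.trans
      (hS [] h _ (hqS 1) List.nil_prefix)))
  have hF : ∀ p ∈ F.map ⟨q, hq⟩, p ∈ S := by
    intro p hp
    obtain ⟨i, -, hi⟩ := Finset.mem_map.1 hp
    exact hi ▸ hqS i
  have hud : InformationTheory.UniquelyDecodable (↑(F.map ⟨q, hq⟩) : Set (List Bool)) :=
    uniquelyDecodable_of_prefixFree (fun h => hnil (hF _ h))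
      fun p hp p' hp' => hS p (hF p hp) p' (hF p' hp')
  have h := InformationTheory.kraft_mcmillan_inequality hud
  simpa using h

theorem summable_half_pow_length {S : Set (List Bool)}
    (hS : ∀ p ∈ S, ∀ p' ∈ S, p <+: p' → p = p') {q : ℕ → List Bool} (hq : Function.Injective q)
    (hqS : ∀ i, q i ∈ S) : Summable fun i => (1 / 2 : ℝ) ^ (q i).length :=
  summable_of_sum_le (fun _ => by positivity) (sum_half_pow_length_le_one hS hq hqS)

/-! ### Moments of the length distribution -/

section Moments

variable {x : ℕ → ℕ}

theorem tendsto_length_atTop (hx : Summable fun i => (1 / 2 : ℝ) ^ x i) :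
    Tendsto x cofinite atTop := by
  rw [tendsto_atTop]
  intro b
  have h := hx.tendsto_cofinite_zero.eventually_lt_const (show (0 : ℝ) < (1 / 2) ^ b by positivity)
  filter_upwards [h] with i hi
  exact (pow_lt_pow_iff_right_of_lt_one₀ (by norm_num) (by norm_num)).1 hi |>.le

theorem exists_pow_mul_pow_le (k : ℕ) {a : ℝ} (ha0 : 0 ≤ a) (ha : a < 1) :
    ∃ C, 0 < C ∧ ∀ n : ℕ, (n : ℝ) ^ k * a ^ n ≤ C := by
  obtain ⟨C, hC⟩ := (tendsto_pow_const_mul_const_pow_of_lt_one k ha0 ha).bddAbove_range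
  exact ⟨max C 1, by positivity, fun n => (hC ⟨n, rfl⟩).trans (le_max_left _ _)⟩

theorem summable_moment (hx : Summable fun i => (1 / 2 : ℝ) ^ x i) (k : ℕ) {b : ℝ} (hb0 : 0 ≤ b)
    (hb : b < 1 / 2) : Summable fun i => (x i : ℝ) ^ k * b ^ x i := by
  obtain ⟨C, hC0, hC⟩ := exists_pow_mul_pow_le k (a := 2 * b) (by linarith) (by linarith)
  refine Summable.of_nonneg_of_le (fun i => by positivity) (fun i => ?_) (hx.mul_left C)
  calc (x i : ℝ) ^ k * b ^ x i = ((x i : ℝ) ^ k * (2 * b) ^ x i) * (1 / 2) ^ x i := by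
        rw [mul_assoc, ← mul_pow]; ring_nf
    _ ≤ C * (1 / 2) ^ x i := by gcongr; exact hC _

/-- If the tail of the sum of `2 ^ (-x i)` is at most `2 ^ (-k)`, then the tail of the second moment
with base `b` is `O(k ^ 2 * b ^ k)`. -/
theorem exists_tail_moment_le (hx : Summable fun i => (1 / 2 : ℝ) ^ x i) {b : ℝ} (hb0 : 0 < b)
    (hb : b < 1 / 2) : ∃ C, 0 < C ∧ ∀ (F : Finset ℕ) (k : ℕ), 0 < k →
      (∑' i : {i // i ∉ F}, (1 / 2 : ℝ) ^ x i) ≤ (1 / 2) ^ k →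
      (∑' i : {i // i ∉ F}, (x i : ℝ) ^ 2 * b ^ x i) ≤ C * (k : ℝ) ^ 2 * b ^ k := by
  obtain ⟨C, hC0, hC⟩ := exists_pow_mul_pow_le 2 (a := 2 * b) (by linarith) (by linarith)
  refine ⟨C / (2 * b), by positivity, fun F k hk hF => ?_⟩
  have hs : Summable fun i : {i // i ∉ F} => (1 / 2 : ℝ) ^ x i := hx.subtype _
  have hterm : ∀ i : {i // i ∉ F}, (x i : ℝ) ^ 2 * b ^ x i ≤
      (C / (2 * b) * (k : ℝ) ^ 2 * (2 * b) ^ k) * (1 / 2) ^ x i := by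
    intro i
    -- A single term is bounded by the whole tail, so every length outside `F` is at least `k`;
    -- write it as `k + j`.
    have h1 : (1 / 2 : ℝ) ^ x i ≤ (1 / 2) ^ k :=
      (hs.le_tsum i fun j _ => by positivity).trans hF
    have h2 : k ≤ x i := by
      by_contra hlt
      exact absurd h1 (not_le.2 (pow_lt_pow_right_of_lt_one₀ (by norm_num) (by norm_num) (by omega)))
    obtain ⟨j, hj⟩ := Nat.exists_eq_add_of_le h2
    have h3 : ((k : ℝ) + j) ^ 2 ≤ k ^ 2 * ((j + 1 : ℕ) : ℝ) ^ 2 := by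
      rw [← mul_pow]
      have : (1 : ℝ) ≤ k := by exact_mod_cast hk
      push_cast
      gcongr
      nlinarith [(Nat.cast_nonneg j : (0 : ℝ) ≤ j)]
    have h4 := hC (j + 1)
    have h5 : ((j + 1 : ℕ) : ℝ) ^ 2 * (2 * b) ^ j ≤ C / (2 * b) := by
      rw [le_div_iff₀ (by positivity), mul_assoc, ← pow_succ]
      exact h4
    rw [hj]
    push_cast
    calc ((k : ℝ) + j) ^ 2 * b ^ (k + j) = ((k : ℝ) + j) ^ 2 * ((2 * b) ^ (k + j) * (1 / 2) ^ (k + j)) := by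
          rw [← mul_pow]; ring_nf
      _ ≤ (k ^ 2 * ((j + 1 : ℕ) : ℝ) ^ 2) * ((2 * b) ^ (k + j) * (1 / 2) ^ (k + j)) := by gcongr
      _ = (((j + 1 : ℕ) : ℝ) ^ 2 * (2 * b) ^ j) * k ^ 2 * (2 * b) ^ k * (1 / 2) ^ (k + j) := by ring
      _ ≤ C / (2 * b) * k ^ 2 * (2 * b) ^ k * (1 / 2) ^ (k + j) := by gcongr
  calc (∑' i : {i // i ∉ F}, (x i : ℝ) ^ 2 * b ^ x i)
      ≤ ∑' i : {i // i ∉ F}, (C / (2 * b) * (k : ℝ) ^ 2 * (2 * b) ^ k) * (1 / 2) ^ x i :=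
        Summable.tsum_le_tsum hterm ((summable_moment hx 2 hb0.le hb).subtype _) (hs.mul_left _)
    _ = (C / (2 * b) * (k : ℝ) ^ 2 * (2 * b) ^ k) * ∑' i : {i // i ∉ F}, (1 / 2 : ℝ) ^ x i := by
        rw [tsum_mul_left]
    _ ≤ (C / (2 * b) * (k : ℝ) ^ 2 * (2 * b) ^ k) * (1 / 2) ^ k := by gcongr
    _ = C / (2 * b) * (k : ℝ) ^ 2 * b ^ k := by
        rw [mul_assoc, ← mul_pow]; ring_nf

end Moments

end AIT

/-! ### Differentiation of the energies, header codes, and the case `T = 1` -/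

namespace AIT

/-! ### Derivatives of the energies -/

theorem two_rpow_neg_div (n : ℕ) (t : ℝ) :
    (2 : ℝ) ^ (-(n : ℝ) / t) = ((2 : ℝ) ^ (-(1 / t))) ^ n := by
  rw [← Real.rpow_mul_natCast (by norm_num)]; congr 1; ring

theorem two_rpow_neg_inv_pos (t : ℝ) : 0 < (2 : ℝ) ^ (-(1 / t)) := by positivity

theorem two_rpow_neg_inv_lt_half {t : ℝ} (h0 : 0 < t) (h1 : t < 1) :
    (2 : ℝ) ^ (-(1 / t)) < 1 / 2 := by
  have h : (1 / 2 : ℝ) = 2 ^ (-1 : ℝ) := by rw [Real.rpow_neg_one]; norm_num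
  rw [h]
  apply Real.rpow_lt_rpow_of_exponent_lt (by norm_num)
  have := (one_lt_div h0).2 h1
  linarith

theorem hasDerivAt_moment_term (n k : ℕ) {t : ℝ} (ht : 0 < t) :
    HasDerivAt (fun s : ℝ => (n : ℝ) ^ k * (2 : ℝ) ^ (-(n : ℝ) / s))
      (Real.log 2 / t ^ 2 * ((n : ℝ) ^ (k + 1) * (2 : ℝ) ^ (-(n : ℝ) / t))) t := by
  have h1 : HasDerivAt (fun s : ℝ => -(n : ℝ) / s) ((n : ℝ) / t ^ 2) t := by
    simpa using (hasDerivAt_const t (-(n : ℝ))).fun_div (hasDerivAt_id' t) ht.ne'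
  have h2 := (h1.const_rpow (show (0 : ℝ) < 2 by norm_num)).const_mul ((n : ℝ) ^ k)
  refine h2.congr_deriv ?_
  ring

/-- For moments, differentiation raises the order by one up to the common factor `c`; the quotient
rule then turns the derivative of a mean into `c` times a variance. -/
theorem hasDerivAt_div_of_moments {f g : ℝ → ℝ} {c s2 t : ℝ} (hg : g t ≠ 0)
    (hf' : HasDerivAt f (c * s2) t) (hg' : HasDerivAt g (c * f t) t) :
    HasDerivAt (fun s => f s / g s) (c * ((s2 * g t - f t ^ 2) / g t ^ 2)) t := by
  refine (hf'.div hg' hg).congr_deriv ?_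
  ring

section Energy

variable {q : ℕ → List Bool}

theorem energyN_eq (q : ℕ → List Bool) (n : ℕ) (t : ℝ) :
    energyN q n t = (∑ i ∈ Finset.range n, ((q i).length : ℝ) ^ 1 * (2 : ℝ) ^ (-((q i).length : ℝ) / t)) /
      ∑ i ∈ Finset.range n, ((q i).length : ℝ) ^ 0 * (2 : ℝ) ^ (-((q i).length : ℝ) / t) := by
  simp only [energyN, partitionN, pow_one, pow_zero, one_mul]
  ring

theorem hasDerivAt_energyN (q : ℕ → List Bool) (n : ℕ) {t : ℝ} (ht : 0 < t) :
    HasDerivAt (energyN q n) (Real.log 2 / t ^ 2 * finVar (fun i => ((q i).length : ℝ))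
      (fun i => ((2 : ℝ) ^ (-(1 / t))) ^ (q i).length) (Finset.range n)) t := by
  have hS : ∀ k, HasDerivAt (fun s => ∑ i ∈ Finset.range n,
      ((q i).length : ℝ) ^ k * (2 : ℝ) ^ (-((q i).length : ℝ) / s))
      (Real.log 2 / t ^ 2 * ∑ i ∈ Finset.range n,
        ((q i).length : ℝ) ^ (k + 1) * (2 : ℝ) ^ (-((q i).length : ℝ) / t)) t := by
    intro k
    rw [Finset.mul_sum]
    exact HasDerivAt.fun_sum fun i _ => hasDerivAt_moment_term _ k ht
  rcases Nat.eq_zero_or_pos n with rfl | hn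
  · have : energyN q 0 = fun _ => 0 := by ext s; simp [energyN]
    simpa [this, finVar] using hasDerivAt_const t (0 : ℝ)
  rw [show energyN q n = _ from funext (energyN_eq q n)]
  have hpos : (∑ i ∈ Finset.range n,
      ((q i).length : ℝ) ^ 0 * (2 : ℝ) ^ (-((q i).length : ℝ) / t)) ≠ 0 := by
    refine (Finset.sum_pos (fun i _ => by positivity) ⟨0, Finset.mem_range.2 hn⟩).ne'
  refine (hasDerivAt_div_of_moments hpos (hS 1) (hS 0)).congr_deriv ?_
  simp only [finVar, two_rpow_neg_div, pow_one, pow_zero, one_mul]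

theorem specificHeatN_eq (q : ℕ → List Bool) (n : ℕ) {t : ℝ} (ht : 0 < t) :
    specificHeatN q n t = Real.log 2 / t ^ 2 * finVar (fun i => ((q i).length : ℝ))
      (fun i => ((2 : ℝ) ^ (-(1 / t))) ^ (q i).length) (Finset.range n) :=
  (hasDerivAt_energyN q n ht).deriv

variable (hq : Summable fun i => (1 / 2 : ℝ) ^ (q i).length)
include hq

theorem summable_moment_rpow (k : ℕ) {t : ℝ} (h0 : 0 < t) (h1 : t < 1) :
    Summable fun i => ((q i).length : ℝ) ^ k * (2 : ℝ) ^ (-((q i).length : ℝ) / t) := by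
  simp only [two_rpow_neg_div]
  exact summable_moment hq k (two_rpow_neg_inv_pos t).le (two_rpow_neg_inv_lt_half h0 h1)

theorem tsum_moment_zero_pos {t : ℝ} (h0 : 0 < t) (h1 : t < 1) :
    0 < ∑' i, ((q i).length : ℝ) ^ 0 * (2 : ℝ) ^ (-((q i).length : ℝ) / t) :=
  (summable_moment_rpow hq 0 h0 h1).tsum_pos (fun i => by positivity) 0 (by positivity)

theorem tendsto_energyN {t : ℝ} (h0 : 0 < t) (h1 : t < 1) :
    Tendsto (fun n => energyN q n t) atTop
      (𝓝 ((∑' i, ((q i).length : ℝ) ^ 1 * (2 : ℝ) ^ (-((q i).length : ℝ) / t)) /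
      ∑' i, ((q i).length : ℝ) ^ 0 * (2 : ℝ) ^ (-((q i).length : ℝ) / t))) := by
  simp only [energyN_eq]
  exact ((summable_moment_rpow hq 1 h0 h1).hasSum.tendsto_sum_nat).div
    ((summable_moment_rpow hq 0 h0 h1).hasSum.tendsto_sum_nat) (tsum_moment_zero_pos hq h0 h1).ne'

theorem hasDerivAt_tsum_moment (k : ℕ) {t : ℝ} (h0 : 0 < t) (h1 : t < 1) :
    HasDerivAt (fun s : ℝ => ∑' i, ((q i).length : ℝ) ^ k * (2 : ℝ) ^ (-((q i).length : ℝ) / s))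
      (Real.log 2 / t ^ 2 *
        ∑' i, ((q i).length : ℝ) ^ (k + 1) * (2 : ℝ) ^ (-((q i).length : ℝ) / t)) t := by
  -- On `(a, b)` the derivatives are dominated by using `a` in the factor `1 / s ^ 2` and `b` in the
  -- exponential; `b < 1` keeps the dominating series summable.
  obtain ⟨a, ha0, hat⟩ := exists_between h0
  obtain ⟨b, hbt, hb1⟩ := exists_between h1
  have hb0 : 0 < b := h0.trans hbt
  rw [← tsum_mul_left]
  refine hasDerivAt_tsum_of_isPreconnected (t := Set.Ioo a b) (y₀ := t)
    (u := fun i => Real.log 2 / a ^ 2 *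
      (((q i).length : ℝ) ^ (k + 1) * (2 : ℝ) ^ (-((q i).length : ℝ) / b)))
    ((summable_moment_rpow hq (k + 1) hb0 hb1).mul_left _) isOpen_Ioo isPreconnected_Ioo
    (fun i y hy => hasDerivAt_moment_term _ k (ha0.trans hy.1)) (fun i y hy => ?_) ⟨hat, hbt⟩
    (summable_moment_rpow hq k h0 h1) ⟨hat, hbt⟩
  have hlog : 0 < Real.log 2 := Real.log_pos (by norm_num)
  rw [Real.norm_of_nonneg (by positivity)]
  have hy0 : 0 < y := ha0.trans hy.1
  have e : -((q i).length : ℝ) / y ≤ -((q i).length : ℝ) / b := by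
    rw [neg_div, neg_div, neg_le_neg_iff]
    exact div_le_div_of_nonneg_left (Nat.cast_nonneg _) hy0 hy.2.le
  have h2 : (2 : ℝ) ^ (-((q i).length : ℝ) / y) ≤ (2 : ℝ) ^ (-((q i).length : ℝ) / b) :=
    Real.rpow_le_rpow_of_exponent_le (by norm_num) e
  have h3 : a ^ 2 ≤ y ^ 2 := pow_le_pow_left₀ ha0.le hy.1.le 2
  gcongr

theorem energy_eq {t : ℝ} (h0 : 0 < t) (h1 : t < 1) :
    energy q t = (∑' i, ((q i).length : ℝ) ^ 1 * (2 : ℝ) ^ (-((q i).length : ℝ) / t)) /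
      ∑' i, ((q i).length : ℝ) ^ 0 * (2 : ℝ) ^ (-((q i).length : ℝ) / t) :=
  (tendsto_energyN hq h0 h1).limUnder_eq

theorem tendsto_specificHeatN {t : ℝ} (h0 : 0 < t) (h1 : t < 1) :
    Tendsto (fun n => specificHeatN q n t) atTop
      (𝓝 (Real.log 2 / t ^ 2 * totalVar (fun i => ((q i).length : ℝ))
        (fun i => ((2 : ℝ) ^ (-(1 / t))) ^ (q i).length))) := by
  simp only [specificHeatN_eq q _ h0]
  have hs := fun k => summable_moment hq k (two_rpow_neg_inv_pos t).le (two_rpow_neg_inv_lt_half h0 h1)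
  exact (tendsto_finVar tendsto_finset_range (fun i => by positivity) (by simpa using hs 0)
    (by simpa using hs 1) (hs 2)).const_mul _

theorem specificHeat_eq {t : ℝ} (h0 : 0 < t) (h1 : t < 1) :
    specificHeat q t = Real.log 2 / t ^ 2 * totalVar (fun i => ((q i).length : ℝ))
        (fun i => ((2 : ℝ) ^ (-(1 / t))) ^ (q i).length) :=
  (tendsto_specificHeatN hq h0 h1).limUnder_eq

theorem hasDerivAt_energy {t : ℝ} (h0 : 0 < t) (h1 : t < 1) :
    HasDerivAt (energy q) (specificHeat q t) t := by
  have h := hasDerivAt_div_of_moments (tsum_moment_zero_pos hq h0 h1).ne'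
    (hasDerivAt_tsum_moment hq 1 h0 h1) (hasDerivAt_tsum_moment hq 0 h0 h1)
  have heq : energy q =ᶠ[𝓝 t] fun t =>
      (∑' i, ((q i).length : ℝ) ^ 1 * (2 : ℝ) ^ (-((q i).length : ℝ) / t)) /
      ∑' i, ((q i).length : ℝ) ^ 0 * (2 : ℝ) ^ (-((q i).length : ℝ) / t) := by
    filter_upwards [isOpen_Ioo.mem_nhds (Set.mem_Ioo.2 ⟨h0, h1⟩)] with s hs
    exact energy_eq hq hs.1 hs.2
  refine (h.congr_of_eventuallyEq heq).congr_deriv ?_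
  rw [specificHeat_eq hq h0 h1, totalVar]
  simp only [two_rpow_neg_div, pow_one, pow_zero, one_mul]

end Energy

/-! ### Codes consisting of a unary header and a body whose length depends on the header -/

/-- The strings `0 ^ m 1 v` with `v` of length `h m`. -/
def IsHeaderCode (h : ℕ → ℕ) (p : List Bool) : Prop :=
  p.length = p.idxOf true + 1 + h (p.idxOf true)

instance (h : ℕ → ℕ) : DecidablePred (IsHeaderCode h) := fun _ => inferInstanceAs (Decidable (_ = _))

/-- The position of the first `true` is shared by both strings and determines their length. -/
theorem IsHeaderCode.eq_of_prefix {h : ℕ → ℕ} {p p' : List Bool} (hp : IsHeaderCode h p)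
    (hp' : IsHeaderCode h p') (hpre : p <+: p') : p = p' := by
  have hmem : true ∈ p := List.idxOf_lt_length_iff.1 (by unfold IsHeaderCode at hp; omega)
  have hidx : p'.idxOf true = p.idxOf true := by
    obtain ⟨r, rfl⟩ := hpre
    exact List.idxOf_append_of_mem hmem
  refine hpre.eq_of_length ?_
  rw [hp, hp', hidx]

theorem idxOf_true_header (m : ℕ) (v : List Bool) :
    (List.replicate m false ++ true :: v).idxOf true = m := by
  rw [List.idxOf_append_of_notMem (by simp)]
  simp

theorem isHeaderCode_header {h : ℕ → ℕ} {m : ℕ} {v : List Bool} (hv : v.length = h m) :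
    IsHeaderCode h (List.replicate m false ++ true :: v) := by
  rw [IsHeaderCode, idxOf_true_header]
  simp [hv]; omega

theorem primrecPred_isHeaderCode {h : ℕ → ℕ} (hh : Primrec h) : PrimrecPred (IsHeaderCode h) := by
  have hidx : Primrec fun p : List Bool => p.idxOf true := Primrec.list_idxOf.comp (Primrec.const true) Primrec.id
  exact Primrec.eq.comp Primrec.list_length
    (Primrec.nat_add.comp (Primrec.succ.comp hidx) (hh.comp hidx))

theorem isComputer_identity {h : ℕ → ℕ} (hh : Primrec h) :
    IsComputer fun p => Part.ofOption (if IsHeaderCode h p then some p else none) := by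
  constructor
  · exact (Primrec.ite (primrecPred_isHeaderCode hh) Primrec.option_some
      (Primrec.const none)).to_comp.ofOption
  · have key : ∀ p ∈ (PFun.Dom fun p : List Bool =>
        Part.ofOption (if IsHeaderCode h p then some p else none)),
        IsHeaderCode h p := by
      intro p hp
      by_contra hcon
      simp [PFun.Dom, hcon] at hp
    exact fun p hp p' hp' => (key p hp).eq_of_prefix (key p' hp')

/-! ### Divergence at temperature one -/

/-- Use the header code with bodies of length `2 ^ j`. The strings with header `j` have total weight
`2 ^ (-(j + 1))` but length above `2 ^ j`, so each block contributes at least `1 / 2` to the mean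
length. Optimality transfers this to `U` at the cost of a constant. -/
theorem not_summable_length {U : List Bool →. List Bool} (hU : IsOptimal U) {q : ℕ → List Bool}
    (hq_range : Set.range q = U.Dom) :
    ¬ Summable fun i => ((q i).length + 1 : ℝ) * (1 / 2) ^ (q i).length := by
  intro hs
  have hpow : Primrec fun m : ℕ => 2 ^ m := Primrec₂.unpaired'.1 Nat.Primrec.pow |>.comp (Primrec.const 2) Primrec.id
  obtain ⟨c, hc⟩ := hU.2 _ (isComputer_identity hpow)
  set P : (Σ j : ℕ, (Fin (2 ^ j) → Bool)) → List Bool := fun s =>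
    List.replicate s.1 false ++ true :: List.ofFn s.2 with hP
  have hPinj : Function.Injective P := by
    rintro ⟨j, v⟩ ⟨j', v'⟩ he
    have h1 := congrArg (List.idxOf true) he
    simp only [hP, idxOf_true_header] at h1
    subst h1
    simp only [hP, List.append_cancel_left_eq, List.cons.injEq, true_and] at he
    rw [List.ofFn_injective he]
  have hex : ∀ s, ∃ i, P s ∈ U (q i) ∧ (q i).length ≤ (P s).length + c := by
    intro s
    obtain ⟨p', h1, h2⟩ := hc (P s) (P s) (by
      rw [if_pos (isHeaderCode_header (by simp))]; simp)
    have : p' ∈ Set.range q := hq_range ▸ Part.dom_iff_mem.2 ⟨_, h1⟩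
    obtain ⟨i, rfl⟩ := this
    exact ⟨i, h1, h2⟩
  choose I hI hIlen using hex
  have hIinj : Function.Injective I := fun s s' he =>
    hPinj (Part.mem_unique (hI s) (he ▸ hI s'))
  -- The `+ 1` in the summand is needed here: `n / 2 ^ n` increases from `n = 0` to `n = 1`.
  have hanti : Antitone fun n : ℕ => ((n : ℝ) + 1) * (1 / 2) ^ n := by
    refine antitone_nat_of_succ_le fun n => ?_
    rw [pow_succ]
    push_cast
    have : (0 : ℝ) < (1 / 2) ^ n := by positivity
    nlinarith [(Nat.cast_nonneg n : (0 : ℝ) ≤ n)]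
  have h1 : Summable fun s : (Σ j : ℕ, (Fin (2 ^ j) → Bool)) =>
      (((P s).length + c : ℕ) + 1 : ℝ) * (1 / 2) ^ ((P s).length + c) :=
    Summable.of_nonneg_of_le (fun s => by positivity) (fun s => hanti (hIlen s))
      (hs.comp_injective hIinj)
  have h2 := h1.sigma.tendsto_atTop_zero
  have h3 : ∀ j : ℕ, (1 / 2 : ℝ) ^ (c + 1) ≤ ∑' v : Fin (2 ^ j) → Bool,
      (((P ⟨j, v⟩).length + c : ℕ) + 1 : ℝ) * (1 / 2) ^ ((P ⟨j, v⟩).length + c) := by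
    intro j
    have hl : ∀ v, (P ⟨j, v⟩).length = j + (2 ^ j + 1) := by intro v; simp [hP]
    simp only [hl, tsum_fintype, Finset.sum_const, Finset.card_univ, Fintype.card_fun,
      Fintype.card_bool, Fintype.card_fin, nsmul_eq_mul]
    push_cast
    have e : (2 : ℝ) ^ (2 ^ j) * (((j : ℝ) + (2 ^ j + 1) + c + 1) * (1 / 2) ^ (j + (2 ^ j + 1) + c)) =
        ((j : ℝ) + (2 ^ j + 1) + c + 1) * (1 / 2) ^ j * (1 / 2) ^ (c + 1) * (2 * (1 / 2)) ^ (2 ^ j) := by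
      rw [mul_pow]; ring
    rw [e]
    have h4 : (1 : ℝ) ≤ ((j : ℝ) + (2 ^ j + 1) + c + 1) * (1 / 2) ^ j := by
      rw [one_div, inv_pow, ← div_eq_mul_inv, le_div_iff₀ (by positivity)]
      have := (Nat.cast_nonneg j : (0 : ℝ) ≤ j)
      have := (Nat.cast_nonneg c : (0 : ℝ) ≤ c)
      linarith
    simp only [mul_one_div_cancel (two_ne_zero' ℝ), one_pow, mul_one]
    exact le_mul_of_one_le_left (by positivity) h4
  have h4 := ge_of_tendsto' h2 h3
  have h5 : (0 : ℝ) < (1 / 2) ^ (c + 1) := by positivity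
  exact absurd h4 (not_le.2 h5)

/-- Only the term of `q 0` in the variance is kept. The total weight is at most `Z` and the mean is
at least `s1 / Z`, which tends to infinity. -/
theorem tendsto_specificHeatN_one {U : List Bool →. List Bool} (hU : IsOptimal U)
    {q : ℕ → List Bool} (hq_range : Set.range q = U.Dom)
    (hq : Summable fun i => (1 / 2 : ℝ) ^ (q i).length) :
    Tendsto (fun n => specificHeatN q n 1) atTop atTop := by
  have hb : (2 : ℝ) ^ (-(1 / 1) : ℝ) = 1 / 2 := by rw [div_one, Real.rpow_neg_one]; norm_num
  simp only [specificHeatN_eq q _ one_pos, hb]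
  have hlog : 0 < Real.log 2 := Real.log_pos (by norm_num)
  refine Tendsto.const_mul_atTop (by positivity) ?_
  set w : ℕ → ℝ := fun i => (1 / 2 : ℝ) ^ (q i).length with hw
  set y : ℕ → ℝ := fun i => ((q i).length : ℝ) with hy
  have hwpos : ∀ i, 0 < w i := fun i => by positivity
  set Z := ∑' i, w i with hZ
  have hZpos : 0 < Z := hq.tsum_pos (fun i => (hwpos i).le) 0 (hwpos 0)
  have hns : ¬ Summable fun i => y i * w i := fun h =>
    not_summable_length hU hq_range ((h.add hq).congr fun i => by simp [hy, hw]; ring)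
  have hS1 : Tendsto (fun n => ∑ i ∈ Finset.range n, y i * w i) atTop atTop :=
    (not_summable_iff_tendsto_nat_atTop_of_nonneg fun i => by positivity).1 hns
  have hlim : Tendsto (fun n => w 0 / Z * ((∑ i ∈ Finset.range n, y i * w i) / Z - y 0) ^ 2)
      atTop atTop :=
    Tendsto.const_mul_atTop (by have := hwpos 0; positivity) ((tendsto_pow_atTop two_ne_zero).comp
      (tendsto_atTop_add_const_right _ (-y 0) (hS1.atTop_div_const hZpos)))
  refine tendsto_atTop_mono' _ ?_ hlim
  filter_upwards [eventually_ge_atTop 1, hS1.eventually_ge_atTop (y 0 * Z)] with n hn hn1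
  have h0 : 0 ∈ Finset.range n := Finset.mem_range.2 hn
  have hs0le : ∑ i ∈ Finset.range n, w i ≤ Z := hq.sum_le_tsum _ fun i _ => (hwpos i).le
  have hs0 : 0 < ∑ i ∈ Finset.range n, w i := Finset.sum_pos (fun i _ => hwpos i) ⟨0, h0⟩
  set s0 := ∑ i ∈ Finset.range n, w i with hs0def
  set s1 := ∑ i ∈ Finset.range n, y i * w i with hs1def
  have hs1 : 0 ≤ s1 := Finset.sum_nonneg fun i _ => by positivity
  have key : s0 * finVar y w (Finset.range n) =
      ∑ i ∈ Finset.range n, w i * (y i - s1 / s0) ^ 2 := by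
    have : ∀ i, w i * (y i - s1 / s0) ^ 2 =
        y i ^ 2 * w i - 2 * (s1 / s0) * (y i * w i) + (s1 / s0) ^ 2 * w i := fun i => by ring
    simp only [this, Finset.sum_add_distrib, Finset.sum_sub_distrib, ← Finset.mul_sum, finVar,
      ← hs0def, ← hs1def]
    field_simp
    ring
  have h1 : w 0 * (y 0 - s1 / s0) ^ 2 ≤ s0 * finVar y w (Finset.range n) := by
    rw [key]
    exact Finset.single_le_sum (f := fun i => w i * (y i - s1 / s0) ^ 2)
      (fun i _ => mul_nonneg (hwpos i).le (sq_nonneg _)) h0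
  have h2 : s1 / Z ≤ s1 / s0 := by gcongr
  have h3 : 0 ≤ s1 / Z - y 0 := by
    have := (le_div_iff₀ hZpos).2 hn1
    linarith
  have h4 : (s1 / Z - y 0) ^ 2 ≤ (y 0 - s1 / s0) ^ 2 := by
    rw [← neg_sq (y 0 - _)]
    exact pow_le_pow_left₀ h3 (by linarith) 2
  have h5 : w 0 * (s1 / Z - y 0) ^ 2 ≤ Z * finVar y w (Finset.range n) :=
    (mul_le_mul_of_nonneg_left h4 (hwpos 0).le).trans (h1.trans (mul_le_mul_of_nonneg_right hs0le
      (finVar_nonneg (fun i => (hwpos i).le) _)))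
  rw [div_mul_eq_mul_div, div_le_iff₀ hZpos]
  linarith

end AIT

/-! ### Recursive enumerability and effective cuts of reals -/

namespace AIT

/-! ### Primitive recursive functions -/

section Primrec

variable {α β γ : Type*} [Primcodable α] [Primcodable β] [Primcodable γ]

attribute [fun_prop] Primrec Computable
attribute [fun_prop] Primrec.id Primrec.const Primrec.comp Computable.id Computable.const
  Computable.comp

@[fun_prop]
theorem primrec_fst {f : α → β × γ} (hf : Primrec f) : Primrec fun a => (f a).1 :=
  Primrec.fst.comp hf

@[fun_prop]
theorem primrec_snd {f : α → β × γ} (hf : Primrec f) : Primrec fun a => (f a).2 :=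
  Primrec.snd.comp hf

@[fun_prop]
theorem primrec_mk {f : α → β} {g : α → γ} (hf : Primrec f) (hg : Primrec g) :
    Primrec fun a => (f a, g a) :=
  hf.pair hg

@[fun_prop]
theorem primrec_add {f g : α → ℕ} (hf : Primrec f) (hg : Primrec g) : Primrec fun a => f a + g a :=
  Primrec.nat_add.comp hf hg

@[fun_prop]
theorem primrec_sub {f g : α → ℕ} (hf : Primrec f) (hg : Primrec g) : Primrec fun a => f a - g a :=
  Primrec.nat_sub.comp hf hg

@[fun_prop]
theorem primrec_mul {f g : α → ℕ} (hf : Primrec f) (hg : Primrec g) : Primrec fun a => f a * g a :=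
  Primrec.nat_mul.comp hf hg

@[fun_prop]
theorem primrec_div {f g : α → ℕ} (hf : Primrec f) (hg : Primrec g) : Primrec fun a => f a / g a :=
  Primrec.nat_div.comp hf hg

@[fun_prop]
theorem primrec_mod {f g : α → ℕ} (hf : Primrec f) (hg : Primrec g) : Primrec fun a => f a % g a :=
  Primrec.nat_mod.comp hf hg

@[fun_prop]
theorem primrec_pow {f g : α → ℕ} (hf : Primrec f) (hg : Primrec g) : Primrec fun a => f a ^ g a :=
  (Primrec₂.unpaired'.1 Nat.Primrec.pow).comp hf hg

@[fun_prop]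
theorem primrec_unpair {f : α → ℕ} (hf : Primrec f) : Primrec fun a => (f a).unpair :=
  Primrec.unpair.comp hf

@[fun_prop]
theorem computable_fst {f : α → β × γ} (hf : Computable f) : Computable fun a => (f a).1 :=
  Computable.fst.comp hf

@[fun_prop]
theorem computable_snd {f : α → β × γ} (hf : Computable f) : Computable fun a => (f a).2 :=
  Computable.snd.comp hf

@[fun_prop]
theorem computable_mk {f : α → β} {g : α → γ} (hf : Computable f) (hg : Computable g) :
    Computable fun a => (f a, g a) :=
  hf.pair hg

@[fun_prop]
theorem computable_unpair {f : α → ℕ} (hf : Computable f) : Computable fun a => (f a).unpair :=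
  Computable.unpair.comp hf

theorem primrec_sum_range {f : α → ℕ} {g : α × ℕ → ℕ} (hf : Primrec f) (hg : Primrec g) :
    Primrec fun a => ∑ m ∈ Finset.range (f a), g (a, m) := by
  have h : Primrec₂ fun (a : α) (p : ℕ × ℕ) => p.2 + g (a, p.1) := by
    have : Primrec fun x : α × ℕ × ℕ => x.2.2 + g (x.1, x.2.1) := by fun_prop
    exact this.to₂
  refine (Primrec.nat_rec' hf (Primrec.const 0) h).of_eq fun a => ?_
  induction f a with
  | zero => rfl
  | succ n ih => rw [Finset.sum_range_succ, ← ih]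

/-! ### Recursively enumerable predicates -/

/-- A predicate of the form `∃ n, R a n` with `R` computable. -/
def IsRE (p : α → Prop) : Prop :=
  ∃ R : α × ℕ → Bool, Computable R ∧ ∀ a, p a ↔ ∃ n, R (a, n) = true

theorem IsRE.of_primrecPred {p : α → Prop} (hp : PrimrecPred p) : IsRE p := by
  obtain ⟨_, hp⟩ := hp
  exact ⟨fun x => decide (p x.1), (hp.comp Primrec.fst).to_comp, fun a => by simp⟩

theorem IsRE.of_iff {p p' : α → Prop} (hp : IsRE p) (h : ∀ a, p' a ↔ p a) : IsRE p' := by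
  rwa [show p' = p from funext fun a => propext (h a)]

theorem IsRE.comp {p : β → Prop} (hp : IsRE p) {f : α → β} (hf : Computable f) :
    IsRE fun a => p (f a) := by
  obtain ⟨R, hR, h⟩ := hp
  exact ⟨fun x => R (f x.1, x.2), by fun_prop, fun a => h (f a)⟩

theorem IsRE.and {p p' : α → Prop} (hp : IsRE p) (hp' : IsRE p') : IsRE fun a => p a ∧ p' a := by
  obtain ⟨R, hR, h⟩ := hp
  obtain ⟨R', hR', h'⟩ := hp'
  refine ⟨fun x => R (x.1, x.2.unpair.1) && R' (x.1, x.2.unpair.2),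
    Primrec.and.to_comp.comp (by fun_prop) (by fun_prop), fun a => ?_⟩
  simp only [h, h', Bool.and_eq_true]
  constructor
  · rintro ⟨⟨n, hn⟩, ⟨m, hm⟩⟩
    exact ⟨Nat.pair n m, by simpa using ⟨hn, hm⟩⟩
  · rintro ⟨n, h1, h2⟩
    exact ⟨⟨_, h1⟩, ⟨_, h2⟩⟩

theorem IsRE.or {p p' : α → Prop} (hp : IsRE p) (hp' : IsRE p') : IsRE fun a => p a ∨ p' a := by
  obtain ⟨R, hR, h⟩ := hp
  obtain ⟨R', hR', h'⟩ := hp'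
  refine ⟨fun x => R x || R' x, Primrec.or.to_comp.comp hR hR', fun a => ?_⟩
  simp only [h, h', Bool.or_eq_true, exists_or]

theorem IsRE.exists {p : α × β → Prop} (hp : IsRE p) : IsRE fun a => ∃ b, p (a, b) := by
  obtain ⟨R, hR, h⟩ := hp
  refine ⟨fun x => Option.casesOn (Encodable.decode (α := β) x.2.unpair.1) false
    fun b => R ((x.1, b), x.2.unpair.2), ?_, fun a => ?_⟩
  · refine Computable.option_casesOn (Computable.decode.comp (by fun_prop)) (Computable.const _) ?_
    have : Computable fun z : (α × ℕ) × β => R ((z.1.1, z.2), z.1.2.unpair.2) := by fun_prop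
    exact this.to₂
  · simp only [h]
    constructor
    · rintro ⟨b, n, hn⟩
      exact ⟨Nat.pair (Encodable.encode b) n, by simpa using hn⟩
    · rintro ⟨n, hn⟩
      rcases hd : Encodable.decode (α := β) n.unpair.1 with _ | b
      · simp [hd] at hn
      · exact ⟨b, n.unpair.2, by simpa [hd] using hn⟩

/-- A witness of a recursively enumerable relation can be found effectively. -/
theorem IsRE.exists_select {p : α × β → Prop} (hp : IsRE p) :
    ∃ f : α →. β, Partrec f ∧ (∀ a, ∀ b ∈ f a, p (a, b)) ∧ ∀ a b, p (a, b) → (f a).Dom := by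
  obtain ⟨R, hR, h⟩ := hp
  -- The search number `n` codes both a candidate `b` and a witness for it.
  have hc : Computable₂ fun (a : α) (n : ℕ) =>
      (Encodable.decode (α := β) n.unpair.1).bind fun b =>
        cond (R ((a, b), n.unpair.2)) (some b) none := by
    refine Computable.option_bind (Computable.decode.comp (by fun_prop)) ?_
    have : Computable fun z : (α × ℕ) × β =>
        cond (R ((z.1.1, z.2), z.1.2.unpair.2)) (some z.2) none :=
      Computable.cond (by fun_prop) (Computable.option_some.comp (by fun_prop)) (by fun_prop)
    exact this.to₂
  refine ⟨_, Partrec.rfindOpt hc, fun a b hb => ?_, fun a b hab => ?_⟩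
  · obtain ⟨n, hn⟩ := Nat.rfindOpt_spec hb
    rw [Option.mem_def, Option.bind_eq_some_iff] at hn
    obtain ⟨b', -, hb'⟩ := hn
    rcases hRb : R ((a, b'), n.unpair.2) with _ | _
    · simp [hRb] at hb'
    · simp only [hRb, cond_true, Option.some.injEq] at hb'
      subst hb'
      exact (h _).2 ⟨_, hRb⟩
  · obtain ⟨n, hn⟩ := (h _).1 hab
    exact Nat.rfindOpt_dom.2 ⟨Nat.pair (Encodable.encode b) n, b, by simp [hn]⟩

end Primrec

/-! ### Effective Dedekind cuts -/

/-- The rationals `r.1 / r.2` below `x` are recursively enumerable. -/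
def IsLowerRE (x : ℝ) : Prop := IsRE fun r : ℕ × ℕ => (r.1 : ℝ) < x * r.2

/-- The rationals `r.1 / r.2` above `x` are recursively enumerable. -/
def IsUpperRE (x : ℝ) : Prop := IsRE fun r : ℕ × ℕ => x * r.2 < r.1

theorem IsRE.natLt {α : Type*} [Primcodable α] {f g : α → ℕ} (hf : Primrec f) (hg : Primrec g) :
    IsRE fun a => f a < g a :=
  .of_primrecPred (Primrec.nat_lt.comp hf hg)

/-- This replaces a real parameter by a rational one on a prescribed side without losing a strict
inequality, which is an open condition. -/
theorem exists_nat_div_lt {P : ℝ → Prop} {x : ℝ} (hx : 0 < x) (hP : ∀ᶠ y in 𝓝 x, P y) :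
    ∃ a b : ℕ, 0 < a ∧ 0 < b ∧ (a : ℝ) / b < x ∧ P (a / b) := by
  obtain ⟨ε, hε, h⟩ := Metric.eventually_nhds_iff.1 hP
  obtain ⟨r, hr1, hr2⟩ := exists_rat_btwn (show max 0 (x - ε) < x by simp [hx, hε])
  have hr0 : (0 : ℝ) < r := (le_max_left _ _).trans_lt hr1
  have hr0' : (0 : ℚ) < r := by exact_mod_cast hr0
  have he : ((r.num.toNat : ℝ)) / r.den = r := by
    have h1 : ((r.num.toNat : ℤ)) = r.num := Int.toNat_of_nonneg (Rat.num_pos.2 hr0').le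
    have h2 : ((r.num.toNat : ℝ)) = (r.num : ℝ) := by exact_mod_cast congrArg (Int.cast (R := ℝ)) h1
    rw [h2]
    exact_mod_cast r.num_div_den
  refine ⟨r.num.toNat, r.den, by have := Rat.num_pos.2 hr0'; omega, r.den_pos, by rwa [he], ?_⟩
  rw [he]
  have := (le_max_right _ _).trans_lt hr1
  exact h (by rw [Real.dist_eq, abs_lt]; constructor <;> linarith)

theorem exists_nat_div_gt {P : ℝ → Prop} {x : ℝ} (hx : 0 < x) (hP : ∀ᶠ y in 𝓝 x, P y) :
    ∃ a b : ℕ, 0 < a ∧ 0 < b ∧ x < (a : ℝ) / b ∧ P (a / b) := by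
  obtain ⟨ε, hε, h⟩ := Metric.eventually_nhds_iff.1 hP
  obtain ⟨y, hy1, hy2⟩ := exists_between (show x < x + ε by linarith)
  have hev : ∀ᶠ z in 𝓝 y, x < z ∧ P z := by
    filter_upwards [isOpen_Ioo.mem_nhds (Set.mem_Ioo.2 ⟨hy1, hy2⟩)] with z hz
    exact ⟨hz.1, h (by rw [Real.dist_eq, abs_lt]; constructor <;> linarith [hz.1, hz.2])⟩
  obtain ⟨a, b, ha, hb, -, h1, h2⟩ := exists_nat_div_lt (hx.trans hy1) hev
  exact ⟨a, b, ha, hb, h1, h2⟩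

/-- The number `x` lies below `a / b` exactly when `f n + 1 / n` does for some `n > 0`. Moving
negative terms across and clearing denominators leaves an inequality of natural numbers. -/
theorem IsComputableReal.isUpperRE {x : ℝ} (hx : IsComputableReal x) : IsUpperRE x := by
  obtain ⟨f, ⟨A, B, C, hA, hB, hC, hf⟩, hfx⟩ := hx
  have hre : IsRE fun z : ((ℕ × ℕ) × ℕ) => 0 < z.2 ∧ A z.2 * z.2 * z.1.2 + (C z.2 + 1) * z.1.2 <
      z.1.1 * z.2 * (C z.2 + 1) + B z.2 * z.2 * z.1.2 := by
    have h : IsRE fun w : (ℕ × ℕ) × ℕ × ℕ × ℕ × ℕ => 0 < w.2.2.2.2 ∧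
        w.2.1 * w.2.2.2.2 * w.1.2 + (w.2.2.2.1 + 1) * w.1.2 <
        w.1.1 * w.2.2.2.2 * (w.2.2.2.1 + 1) + w.2.2.1 * w.2.2.2.2 * w.1.2 :=
      (IsRE.natLt (by fun_prop) (by fun_prop)).and (IsRE.natLt (by fun_prop) (by fun_prop))
    exact h.comp (f := fun z : (ℕ × ℕ) × ℕ => (z.1, A z.2, B z.2, C z.2, z.2)) (by fun_prop)
  refine hre.exists.of_iff fun ⟨a, b⟩ => ?_
  have key : ∀ n : ℕ, 0 < n → (A n * n * b + (C n + 1) * b < a * n * (C n + 1) + B n * n * b ↔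
      ((f n : ℝ) + 1 / n) * b < a) := by
    intro n hn
    have hn' : (0 : ℝ) < n := by exact_mod_cast hn
    have hC' : (0 : ℝ) < (C n : ℝ) + 1 := by positivity
    have : ((f n : ℝ) + 1 / n) * b < a ↔
        ((A n : ℝ) * n * b + (C n + 1) * b < a * n * (C n + 1) + B n * n * b) := by
      rw [hf]; push_cast
      rw [← mul_lt_mul_iff_left₀ (mul_pos hn' hC')]
      have : ((((A n : ℝ) - B n) / (C n + 1)) + 1 / n) * b * (n * (C n + 1)) =
        A n * n * b + (C n + 1) * b - B n * n * b := by field_simp; ring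
      rw [this, sub_lt_iff_lt_add, mul_assoc (a : ℝ)]
    rw [this]; norm_cast
  dsimp only
  constructor
  · intro h
    obtain ⟨n, hn⟩ := exists_nat_gt (2 * b / (a - x * b))
    have hδ : 0 < a - x * b := by linarith
    have hn0 : (0 : ℝ) < n := lt_of_le_of_lt (by positivity) hn
    have hn1 : 0 < n := by exact_mod_cast hn0
    refine ⟨n, hn1, (key n hn1).2 ?_⟩
    have h1 := (abs_lt.1 (hfx n hn1)).1
    have h2 : 2 * b / n < a - x * b := by rwa [div_lt_comm₀ hn0 hδ]
    have h3 : ((f n : ℝ) + 1 / n) * b ≤ (x + 2 / n) * b := by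
      refine mul_le_mul_of_nonneg_right ?_ (Nat.cast_nonneg b)
      have : (2 : ℝ) / n = 1 / n + 1 / n := by ring
      linarith
    have h4 : (x + 2 / n) * b = x * b + 2 * b / n := by ring
    linarith
  · rintro ⟨n, hn, h⟩
    refine lt_of_le_of_lt ?_ ((key n hn).1 h)
    gcongr
    have := (abs_lt.1 (hfx n hn)).2
    linarith

theorem IsComputableReal.isLowerRE {x : ℝ} (hx : IsComputableReal x) : IsLowerRE x := by
  obtain ⟨f, ⟨A, B, C, hA, hB, hC, hf⟩, hfx⟩ := hx
  have hre : IsRE fun z : ((ℕ × ℕ) × ℕ) => 0 < z.2 ∧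
      z.1.1 * z.2 * (C z.2 + 1) + B z.2 * z.2 * z.1.2 + (C z.2 + 1) * z.1.2 <
      A z.2 * z.2 * z.1.2 := by
    have h : IsRE fun w : (ℕ × ℕ) × ℕ × ℕ × ℕ × ℕ => 0 < w.2.2.2.2 ∧
        w.1.1 * w.2.2.2.2 * (w.2.2.2.1 + 1) + w.2.2.1 * w.2.2.2.2 * w.1.2 +
          (w.2.2.2.1 + 1) * w.1.2 < w.2.1 * w.2.2.2.2 * w.1.2 :=
      (IsRE.natLt (by fun_prop) (by fun_prop)).and (IsRE.natLt (by fun_prop) (by fun_prop))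
    exact h.comp (f := fun z : (ℕ × ℕ) × ℕ => (z.1, A z.2, B z.2, C z.2, z.2)) (by fun_prop)
  refine hre.exists.of_iff fun ⟨a, b⟩ => ?_
  have key : ∀ n : ℕ, 0 < n → (a * n * (C n + 1) + B n * n * b + (C n + 1) * b < A n * n * b ↔
      (a : ℝ) < ((f n : ℝ) - 1 / n) * b) := by
    intro n hn
    have hn' : (0 : ℝ) < n := by exact_mod_cast hn
    have hC' : (0 : ℝ) < (C n : ℝ) + 1 := by positivity
    have : (a : ℝ) < ((f n : ℝ) - 1 / n) * b ↔
        (a * n * (C n + 1) + B n * n * b + (C n + 1) * b < (A n : ℝ) * n * b) := by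
      rw [hf]; push_cast
      rw [← mul_lt_mul_iff_left₀ (mul_pos hn' hC')]
      have : ((((A n : ℝ) - B n) / (C n + 1)) - 1 / n) * b * (n * (C n + 1)) =
        A n * n * b - (B n * n * b + (C n + 1) * b) := by field_simp; ring
      rw [this, lt_sub_iff_add_lt, mul_assoc (a : ℝ), add_assoc]
    rw [this]; norm_cast
  dsimp only
  constructor
  · intro h
    obtain ⟨n, hn⟩ := exists_nat_gt (2 * b / (x * b - a))
    have hδ : 0 < x * b - a := by linarith
    have hn0 : (0 : ℝ) < n := lt_of_le_of_lt (by positivity) hn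
    have hn1 : 0 < n := by exact_mod_cast hn0
    refine ⟨n, hn1, (key n hn1).2 ?_⟩
    have h1 := (abs_lt.1 (hfx n hn1)).2
    have h2 : 2 * b / n < x * b - a := by rwa [div_lt_comm₀ hn0 hδ]
    have h3 : (x - 2 / n) * b ≤ ((f n : ℝ) - 1 / n) * b := by
      refine mul_le_mul_of_nonneg_right ?_ (Nat.cast_nonneg b)
      have : (2 : ℝ) / n = 1 / n + 1 / n := by ring
      linarith
    have h4 : (x - 2 / n) * b = x * b - 2 * b / n := by ring
    linarith
  · rintro ⟨n, hn, h⟩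
    refine lt_of_lt_of_le ((key n hn).1 h) ?_
    gcongr
    have := (abs_lt.1 (hfx n hn)).1
    linarith

/-- With `x = c / d`, the condition is `1 / 2 < exp (-x)`, and `(1 - x / n) ^ n` tends to `exp (-x)`
from below, so some `n` certifies it. -/
theorem isLowerRE_log_two : IsLowerRE (Real.log 2) := by
  have hre : IsRE fun z : (ℕ × ℕ) × ℕ => z.1.1 < z.2 * z.1.2 ∧
      (z.2 * z.1.2) ^ z.2 < 2 * (z.2 * z.1.2 - z.1.1) ^ z.2 :=
    (IsRE.natLt (by fun_prop) (by fun_prop)).and (IsRE.natLt (by fun_prop) (by fun_prop))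
  refine hre.exists.of_iff fun ⟨c, d⟩ => ?_
  have key : ∀ n : ℕ, c < n * d → ((n * d) ^ n < 2 * (n * d - c) ^ n ↔
      (1 / 2 : ℝ) < (1 - (c / d : ℝ) / n) ^ n) := by
    intro n hn
    have hnd : 0 < n * d := by omega
    have hn0 : (0 : ℝ) < n := by exact_mod_cast Nat.pos_of_mul_pos_right hnd
    have hd0 : (0 : ℝ) < d := by exact_mod_cast Nat.pos_of_mul_pos_left hnd
    have e : (1 - (c / d : ℝ) / n) = (n * d - c) / (n * d) := by field_simp
    rw [e, div_pow, div_lt_div_iff₀ (by norm_num) (by positivity), one_mul, mul_comm _ (2 : ℝ)]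
    rw [← Nat.cast_lt (α := ℝ)]
    push_cast [Nat.cast_sub hn.le]
    rfl
  dsimp only
  constructor
  · intro h
    have hd0 : (0 : ℝ) < d := by
      by_contra hcon
      have : (d : ℝ) = 0 := le_antisymm (not_lt.1 hcon) (Nat.cast_nonneg d)
      rw [this, mul_zero] at h
      exact absurd h (not_lt.2 (Nat.cast_nonneg c))
    have h1 : (1 / 2 : ℝ) < Real.exp (-(c / d : ℝ)) := by
      rw [one_div, Real.exp_neg]
      refine inv_strictAnti₀ (Real.exp_pos _) ?_
      rw [← Real.lt_log_iff_exp_lt (by norm_num), div_lt_iff₀ hd0]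
      exact h
    have h2 := (Real.tendsto_one_add_div_pow_exp (-(c / d : ℝ))).eventually_const_lt h1
    obtain ⟨n, hn, hn'⟩ := (h2.and (eventually_gt_atTop c)).exists
    have hcn : c < n * d := lt_of_lt_of_le hn' (Nat.le_mul_of_pos_right _ (by exact_mod_cast hd0))
    refine ⟨n, hcn, (key n hcn).2 ?_⟩
    rw [sub_eq_add_neg, ← neg_div]
    exact hn
  · rintro ⟨n, hn, h⟩
    have h1 := (key n hn).1 h
    have hnd : 0 < n * d := by omega
    have hn0 : (0 : ℝ) < n := by exact_mod_cast Nat.pos_of_mul_pos_right hnd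
    have hd0 : (0 : ℝ) < d := by exact_mod_cast Nat.pos_of_mul_pos_left hnd
    have h2 : (1 - (c / d : ℝ) / n) ^ n ≤ Real.exp (-(c / d : ℝ)) := by
      apply Real.one_sub_div_pow_le_exp_neg
      rw [div_le_iff₀ hd0]
      exact_mod_cast hn.le
    have h3 := h1.trans_le h2
    rw [one_div, Real.exp_neg] at h3
    have h4 := (inv_lt_inv₀ (by norm_num) (Real.exp_pos _)).1 h3
    rwa [← Real.lt_log_iff_exp_lt (by norm_num), div_lt_iff₀ hd0] at h4

theorem isUpperRE_log_two : IsUpperRE (Real.log 2) := by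
  have hre : IsRE fun z : (ℕ × ℕ) × ℕ => (0 < z.2 ∧ 0 < z.1.2) ∧
      2 * (z.2 * z.1.2) ^ z.2 < (z.2 * z.1.2 + z.1.1) ^ z.2 :=
    ((IsRE.natLt (by fun_prop) (by fun_prop)).and (IsRE.natLt (by fun_prop) (by fun_prop))).and
      (IsRE.natLt (by fun_prop) (by fun_prop))
  -- For `d = 0` the condition in `IsUpperRE` reads `0 < c` and has to be enumerated separately.
  have hre0 : IsRE fun z : ℕ × ℕ => z.2 < 1 ∧ 0 < z.1 :=
    (IsRE.natLt (by fun_prop) (by fun_prop)).and (IsRE.natLt (by fun_prop) (by fun_prop))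
  refine (hre.exists.or hre0).of_iff fun ⟨c, d⟩ => ?_
  have key : ∀ n : ℕ, 0 < n ∧ 0 < d → (2 * (n * d) ^ n < (n * d + c) ^ n ↔
      (2 : ℝ) < (1 + (c / d : ℝ) / n) ^ n) := by
    rintro n ⟨hn, hd⟩
    have hn0 : (0 : ℝ) < n := by exact_mod_cast hn
    have hd0 : (0 : ℝ) < d := by exact_mod_cast hd
    have e : (1 + (c / d : ℝ) / n) = (n * d + c) / (n * d) := by field_simp
    rw [e, div_pow, lt_div_iff₀ (by positivity), ← Nat.cast_lt (α := ℝ)]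
    push_cast
    rfl
  dsimp only
  constructor
  · intro h
    rcases Nat.eq_zero_or_pos d with rfl | hd
    · right
      simpa using h
    left
    have hd0 : (0 : ℝ) < d := by exact_mod_cast hd
    have h1 : 2 < Real.exp (c / d : ℝ) := by
      rw [← Real.log_lt_iff_lt_exp (by norm_num), lt_div_iff₀ hd0]
      exact h
    have h2 := (Real.tendsto_one_add_div_pow_exp (c / d : ℝ)).eventually_const_lt h1
    obtain ⟨n, hn, hn'⟩ := (h2.and (eventually_gt_atTop 0)).exists
    exact ⟨n, ⟨hn', hd⟩, (key n ⟨hn', hd⟩).2 hn⟩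
  · rintro (⟨n, hn, h⟩ | ⟨h1, h2⟩)
    · have h1 := (key n hn).1 h
      have hn0 : (0 : ℝ) < n := by exact_mod_cast hn.1
      have hd0 : (0 : ℝ) < d := by exact_mod_cast hn.2
      have h2 : (1 + (c / d : ℝ) / n) ^ n ≤ Real.exp (c / d : ℝ) := by
        calc (1 + (c / d : ℝ) / n) ^ n ≤ Real.exp ((c / d : ℝ) / n) ^ n := by
              gcongr
              rw [add_comm]; exact Real.add_one_le_exp _
          _ = Real.exp (c / d : ℝ) := by
              rw [← Real.exp_nat_mul]; congr 1; field_simp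
      rw [← lt_div_iff₀ hd0, Real.log_lt_iff_lt_exp (by norm_num)]
      exact h1.trans_le h2
    · obtain rfl : d = 0 := by omega
      simpa using h2

theorem eventually_two_rpow_neg_inv {T c : ℝ} (hT : 0 < T) :
    Tendsto (fun t : ℝ => c * (2 : ℝ) ^ (-(1 / t))) (𝓝 T) (𝓝 (c * (2 : ℝ) ^ (-(1 / T)))) := by
  refine Tendsto.const_mul _ (Tendsto.rpow tendsto_const_nhds ?_ (Or.inl (by norm_num)))
  exact ((tendsto_const_nhds (x := (1 : ℝ))).div tendsto_id hT.ne').neg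

theorem two_rpow_div_pow {a b : ℕ} (ha : 0 < a) (e : ℝ) :
    (e * (2 : ℝ) ^ (-(1 / ((a : ℝ) / b)))) ^ a = e ^ a / 2 ^ b := by
  have ha' : (a : ℝ) ≠ 0 := by positivity
  rw [mul_pow, ← Real.rpow_mul_natCast (by norm_num)]
  have : -(1 / ((a : ℝ) / b)) * a = -(b : ℝ) := by field_simp
  rw [this, Real.rpow_neg (by norm_num), Real.rpow_natCast]
  rfl

theorem two_rpow_neg_inv_lt {s t : ℝ} (hs : 0 < s) (h : s < t) :
    (2 : ℝ) ^ (-(1 / s)) < (2 : ℝ) ^ (-(1 / t)) := by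
  apply Real.rpow_lt_rpow_of_exponent_lt (by norm_num)
  rw [neg_lt_neg_iff]
  exact one_div_lt_one_div_of_lt hs h

/-- The function is increasing in `T`, and at a rational `a / b` its `a`-th power is `2 ^ (-b)`, so
comparison with `v / e` is integer arithmetic. -/
theorem IsLowerRE.two_rpow_neg_inv {T : ℝ} (hT : 0 < T) (h : IsLowerRE T) :
    IsLowerRE ((2 : ℝ) ^ (-(1 / T))) := by
  have hre : IsRE fun z : (ℕ × ℕ) × ℕ × ℕ => (0 < z.2.1 ∧ z.1.1 ^ z.2.1 * 2 ^ z.2.2 < z.1.2 ^ z.2.1) ∧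
      (z.2.1 : ℝ) < T * z.2.2 :=
    ((IsRE.natLt (by fun_prop) (by fun_prop)).and (IsRE.natLt (by fun_prop) (by fun_prop))).and
      (h.comp Computable.snd)
  refine hre.exists.of_iff fun ⟨v, e⟩ => ?_
  have key : ∀ a b : ℕ, 0 < a → (v ^ a * 2 ^ b < e ^ a ↔
      (v : ℝ) < e * (2 : ℝ) ^ (-(1 / ((a : ℝ) / b)))) := by
    intro a b ha
    rw [← pow_lt_pow_iff_left₀ (a := (v : ℝ)) (Nat.cast_nonneg v) (by positivity) ha.ne', two_rpow_div_pow ha,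
      lt_div_iff₀ (by positivity)]
    norm_cast
  dsimp only
  constructor
  · intro hv
    obtain ⟨a, b, ha, hb, hab, hP⟩ := exists_nat_div_lt hT
      ((eventually_two_rpow_neg_inv (c := e) hT).eventually_const_lt (by rwa [mul_comm]))
    exact ⟨(a, b), ⟨ha, (key a b ha).2 hP⟩, (div_lt_iff₀ (by positivity)).1 hab⟩
  · rintro ⟨⟨a, b⟩, ⟨ha, hab⟩, hT'⟩
    dsimp only at ha hab hT'
    have hb : (0 : ℝ) < b := by
      rcases Nat.eq_zero_or_pos b with rfl | hb
      · simp at hT'; linarith [(Nat.cast_nonneg a : (0 : ℝ) ≤ a)]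
      · exact_mod_cast hb
    refine ((key a b ha).1 hab).trans_le ?_
    rw [mul_comm]
    exact mul_le_mul_of_nonneg_right
      (two_rpow_neg_inv_lt (by positivity) ((div_lt_iff₀ hb).2 hT')).le (Nat.cast_nonneg e)

theorem IsUpperRE.two_rpow_neg_inv {T : ℝ} (hT : 0 < T) (h : IsUpperRE T) :
    IsUpperRE ((2 : ℝ) ^ (-(1 / T))) := by
  have hre : IsRE fun z : (ℕ × ℕ) × ℕ × ℕ => ((0 < z.2.1 ∧ 0 < z.2.2) ∧
      z.1.2 ^ z.2.1 < z.1.1 ^ z.2.1 * 2 ^ z.2.2) ∧ T * z.2.2 < z.2.1 :=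
    (((IsRE.natLt (by fun_prop) (by fun_prop)).and (IsRE.natLt (by fun_prop) (by fun_prop))).and
      (IsRE.natLt (by fun_prop) (by fun_prop))).and (h.comp Computable.snd)
  refine hre.exists.of_iff fun ⟨v, e⟩ => ?_
  have key : ∀ a b : ℕ, 0 < a → (e ^ a < v ^ a * 2 ^ b ↔
      e * (2 : ℝ) ^ (-(1 / ((a : ℝ) / b))) < v) := by
    intro a b ha
    rw [← pow_lt_pow_iff_left₀ (b := (v : ℝ)) (by positivity) (Nat.cast_nonneg v) ha.ne', two_rpow_div_pow ha,
      div_lt_iff₀ (by positivity)]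
    norm_cast
  dsimp only
  constructor
  · intro hv
    obtain ⟨a, b, ha, hb, hab, hP⟩ := exists_nat_div_gt hT
      ((eventually_two_rpow_neg_inv (c := e) hT).eventually_lt_const (by rwa [mul_comm]))
    exact ⟨(a, b), ⟨⟨ha, hb⟩, (key a b ha).2 hP⟩, (lt_div_iff₀ (by positivity)).1 hab⟩
  · rintro ⟨⟨a, b⟩, ⟨⟨ha, hb⟩, hab⟩, hT'⟩
    dsimp only at ha hab hT' hb
    have hb' : (0 : ℝ) < b := by exact_mod_cast hb
    refine lt_of_le_of_lt ?_ ((key a b ha).1 hab)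
    rw [mul_comm]
    exact mul_le_mul_of_nonneg_left
      (two_rpow_neg_inv_lt hT ((lt_div_iff₀ hb').2 hT')).le (Nat.cast_nonneg e)

/-- The quotient decreases in `T`, so a lower cut comes from rationals above `T` and rationals below
`log 2`. -/
theorem isLowerRE_log_two_div_sq {T : ℝ} (hT : 0 < T) (h : IsUpperRE T) :
    IsLowerRE (Real.log 2 / T ^ 2) := by
  have hre : IsRE fun z : (ℕ × ℕ) × (ℕ × ℕ) × ℕ × ℕ => ((0 < z.2.1.2 ∧
      z.1.1 * z.2.1.1 ^ 2 * z.2.2.2 < z.2.2.1 * z.2.1.2 ^ 2 * z.1.2) ∧ T * z.2.1.2 < z.2.1.1) ∧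
      z.2.2.1 < Real.log 2 * z.2.2.2 :=
    (((IsRE.natLt (by fun_prop) (by fun_prop)).and (IsRE.natLt (by fun_prop) (by fun_prop))).and
      (h.comp (f := fun z : (ℕ × ℕ) × (ℕ × ℕ) × ℕ × ℕ => z.2.1) (by fun_prop))).and
      (isLowerRE_log_two.comp (f := fun z : (ℕ × ℕ) × (ℕ × ℕ) × ℕ × ℕ => z.2.2) (by fun_prop))
  have hlog : 0 < Real.log 2 := Real.log_pos (by norm_num)
  refine hre.exists.of_iff fun ⟨g, e⟩ => ?_
  dsimp only
  constructor
  · intro hg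
    have h1 : Tendsto (fun t : ℝ => Real.log 2 / t ^ 2 * e) (𝓝 T) (𝓝 (Real.log 2 / T ^ 2 * e)) :=
      (tendsto_const_nhds.div (tendsto_id.pow 2) (by positivity)).mul_const _
    obtain ⟨a, b, ha, hb, hab, hP⟩ := exists_nat_div_gt hT (h1.eventually_const_lt hg)
    have h2 : Tendsto (fun l : ℝ => l / ((a : ℝ) / b) ^ 2 * e) (𝓝 (Real.log 2))
        (𝓝 (Real.log 2 / ((a : ℝ) / b) ^ 2 * e)) := (tendsto_id.div_const _).mul_const _
    obtain ⟨c, d, hc, hd, hcd, hP'⟩ := exists_nat_div_lt hlog (h2.eventually_const_lt hP)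
    refine ⟨((a, b), (c, d)), ⟨⟨hb, ?_⟩, (lt_div_iff₀ (by positivity)).1 hab⟩,
      (div_lt_iff₀ (by positivity)).1 hcd⟩
    have h3 : ((c : ℝ) / d) / ((a : ℝ) / b) ^ 2 * e = (c * b ^ 2 * e) / (a ^ 2 * d) := by field_simp
    rw [h3, lt_div_iff₀ (by positivity), ← mul_assoc] at hP'
    exact_mod_cast hP'
  · rintro ⟨⟨⟨a, b⟩, ⟨c, d⟩⟩, ⟨⟨hb, h1⟩, h2⟩, h3⟩
    dsimp only at hb h1 h2 h3
    have hb' : (0 : ℝ) < b := by exact_mod_cast hb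
    have ha' : (0 : ℝ) < a := lt_of_le_of_lt (by positivity) h2
    have hd' : (0 : ℝ) < d := by
      rcases Nat.eq_zero_or_pos d with rfl | hd
      · simp at h3; linarith [(Nat.cast_nonneg c : (0 : ℝ) ≤ c)]
      · exact_mod_cast hd
    have h1' : (g : ℝ) * a ^ 2 * d < c * b ^ 2 * e := by exact_mod_cast h1
    have h4 : (g : ℝ) * a ^ 2 * d < Real.log 2 * d * b ^ 2 * e := by
      refine h1'.trans_le ?_
      gcongr
    have h5 : (g : ℝ) * a ^ 2 < Real.log 2 * b ^ 2 * e := by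
      refine lt_of_mul_lt_mul_right ?_ hd'.le
      linarith
    have h6 : (T * b) ^ 2 ≤ (a : ℝ) ^ 2 := by gcongr
    have h7 : (g : ℝ) * (T * b) ^ 2 < Real.log 2 * b ^ 2 * e :=
      lt_of_le_of_lt (mul_le_mul_of_nonneg_left h6 (Nat.cast_nonneg g)) h5
    rw [div_mul_eq_mul_div, lt_div_iff₀ (by positivity)]
    refine lt_of_mul_lt_mul_right ?_ (sq_nonneg (b : ℝ))
    linarith

theorem isUpperRE_log_two_div_sq {T : ℝ} (hT : 0 < T) (h : IsLowerRE T) :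
    IsUpperRE (Real.log 2 / T ^ 2) := by
  have hre : IsRE fun z : (ℕ × ℕ) × (ℕ × ℕ) × ℕ × ℕ => (((0 < z.2.1.1 ∧ 0 < z.2.2.2) ∧
      z.2.2.1 * z.2.1.2 ^ 2 * z.1.2 < z.1.1 * z.2.1.1 ^ 2 * z.2.2.2) ∧ z.2.1.1 < T * z.2.1.2) ∧
      Real.log 2 * z.2.2.2 < z.2.2.1 :=
    ((((IsRE.natLt (by fun_prop) (by fun_prop)).and (IsRE.natLt (by fun_prop) (by fun_prop))).and
      (IsRE.natLt (by fun_prop) (by fun_prop))).and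
      (h.comp (f := fun z : (ℕ × ℕ) × (ℕ × ℕ) × ℕ × ℕ => z.2.1) (by fun_prop))).and
      (isUpperRE_log_two.comp (f := fun z : (ℕ × ℕ) × (ℕ × ℕ) × ℕ × ℕ => z.2.2) (by fun_prop))
  have hlog : 0 < Real.log 2 := Real.log_pos (by norm_num)
  refine hre.exists.of_iff fun ⟨g, e⟩ => ?_
  dsimp only
  constructor
  · intro hg
    have h1 : Tendsto (fun t : ℝ => Real.log 2 / t ^ 2 * e) (𝓝 T) (𝓝 (Real.log 2 / T ^ 2 * e)) :=
      (tendsto_const_nhds.div (tendsto_id.pow 2) (by positivity)).mul_const _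
    obtain ⟨a, b, ha, hb, hab, hP⟩ := exists_nat_div_lt hT (h1.eventually_lt_const hg)
    have h2 : Tendsto (fun l : ℝ => l / ((a : ℝ) / b) ^ 2 * e) (𝓝 (Real.log 2))
        (𝓝 (Real.log 2 / ((a : ℝ) / b) ^ 2 * e)) := (tendsto_id.div_const _).mul_const _
    obtain ⟨c, d, hc, hd, hcd, hP'⟩ := exists_nat_div_gt hlog (h2.eventually_lt_const hP)
    refine ⟨((a, b), (c, d)), ⟨⟨⟨ha, hd⟩, ?_⟩, (div_lt_iff₀ (by positivity)).1 hab⟩,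
      (lt_div_iff₀ (by positivity)).1 hcd⟩
    have h3 : ((c : ℝ) / d) / ((a : ℝ) / b) ^ 2 * e = (c * b ^ 2 * e) / (a ^ 2 * d) := by field_simp
    rw [h3, div_lt_iff₀ (by positivity), ← mul_assoc] at hP'
    exact_mod_cast hP'
  · rintro ⟨⟨⟨a, b⟩, ⟨c, d⟩⟩, ⟨⟨⟨ha, hd⟩, h1⟩, h2⟩, h3⟩
    dsimp only at ha hd h1 h2 h3
    have ha' : (0 : ℝ) < a := by exact_mod_cast ha
    have hd' : (0 : ℝ) < d := by exact_mod_cast hd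
    have h1' : (c : ℝ) * b ^ 2 * e < g * a ^ 2 * d := by exact_mod_cast h1
    have h4 : Real.log 2 * d * b ^ 2 * e < (g : ℝ) * a ^ 2 * d := by
      refine lt_of_le_of_lt ?_ h1'
      gcongr
    have h5 : Real.log 2 * b ^ 2 * e < (g : ℝ) * a ^ 2 := by
      refine lt_of_mul_lt_mul_right ?_ hd'.le
      linarith
    have h6 : (a : ℝ) ^ 2 ≤ (T * b) ^ 2 := by gcongr
    have h7 : Real.log 2 * b ^ 2 * e < (g : ℝ) * (T * b) ^ 2 :=
      lt_of_lt_of_le h5 (mul_le_mul_of_nonneg_left h6 (Nat.cast_nonneg g))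
    rw [div_mul_eq_mul_div, div_lt_iff₀ (by positivity)]
    refine lt_of_mul_lt_mul_right ?_ (sq_nonneg (b : ℝ))
    linarith

end AIT

/-! ### Computable finite stages and interval bounds for their variance -/

namespace AIT

/-! ### Left-computable reals -/

theorem IsLowerRE.isLeftComputable {x : ℝ} (hx : 0 < x) (h : IsLowerRE x) : IsLeftComputable x := by
  obtain ⟨R, hR, hRx⟩ := h
  have hG : Computable fun z : ((ℕ × ℕ) × ℕ) × ℕ × ℕ =>
      cond (R z.1 && decide (z.2.1 * z.1.1.2 < z.1.1.1 * z.2.2)) z.1.1 z.2 := by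
    have h1 : Primrec fun z : ((ℕ × ℕ) × ℕ) × ℕ × ℕ =>
        decide (z.2.1 * z.1.1.2 < z.1.1.1 * z.2.2) :=
      (Primrec.nat_lt.comp (f := fun z : ((ℕ × ℕ) × ℕ) × ℕ × ℕ => z.2.1 * z.1.1.2)
        (g := fun z => z.1.1.1 * z.2.2) (by fun_prop) (by fun_prop)).decide
    exact Computable.cond (Primrec.and.to_comp.comp (hR.comp Computable.fst) h1.to_comp)
      (by fun_prop) (by fun_prop)
  -- The number `n` codes a fraction and a witness for it; the running maximum of the certified
  -- fractions is kept, starting from `0 / 1`.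
  set step : ℕ → ℕ × ℕ → ℕ × ℕ := fun n r =>
    cond (R (n.unpair.1.unpair, n.unpair.2) && decide (r.1 * n.unpair.1.unpair.2 <
      n.unpair.1.unpair.1 * r.2)) n.unpair.1.unpair r with hstep
  have hstepc : Computable fun z : ℕ × ℕ × ℕ => step z.1 z.2 :=
    hG.comp (f := _) (g := fun z : ℕ × ℕ × ℕ => ((z.1.unpair.1.unpair, z.1.unpair.2), z.2))
      (by fun_prop)
  set best : ℕ → ℕ × ℕ := fun n => Nat.rec (0, 1) step n with hbest
  have hbestc : Computable best :=
    Computable.nat_rec (h := fun _ z => step z.1 z.2) Computable.id (Computable.const (0, 1))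
      (hstepc.comp Computable.snd).to₂
  have hsucc : ∀ n, best (n + 1) = step n (best n) := fun n => rfl
  have hinv : ∀ n, 0 < (best n).2 ∧ ((best n).1 : ℝ) ≤ x * (best n).2 := by
    intro n
    induction n with
    | zero => exact ⟨one_pos, by simpa [hbest] using hx.le⟩
    | succ n ih =>
      rw [hsucc]
      simp only [hstep]
      rcases hc : (R (n.unpair.1.unpair, n.unpair.2) && decide ((best n).1 * n.unpair.1.unpair.2 <
        n.unpair.1.unpair.1 * (best n).2)) with _ | _
      · exact ih
      · simp only [Bool.and_eq_true, decide_eq_true_eq] at hc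
        have h1 : ((n.unpair.1.unpair.1 : ℕ) : ℝ) < x * (n.unpair.1.unpair.2 : ℕ) :=
          (hRx _).2 ⟨_, hc.1⟩
        refine ⟨?_, h1.le⟩
        rcases Nat.eq_zero_or_pos n.unpair.1.unpair.2 with h0 | h0
        · rw [h0, Nat.cast_zero, mul_zero] at h1
          exact absurd h1 (not_lt.2 (Nat.cast_nonneg _))
        · exact h0
  set val : ℕ → ℝ := fun n => ((best n).1 : ℝ) / (best n).2 with hval
  have hvalx : ∀ n, val n ≤ x := fun n =>
    (div_le_iff₀ (by exact_mod_cast (hinv n).1)).2 (hinv n).2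
  have hmono : Monotone val := by
    refine monotone_nat_of_le_succ fun n => ?_
    have h1 := (hinv n).1
    have h2 := (hinv (n + 1)).1
    simp only [hval]
    rw [div_le_div_iff₀ (by exact_mod_cast h1) (by exact_mod_cast h2)]
    norm_cast
    rw [hsucc]
    simp only [hstep]
    rcases hc : (R (n.unpair.1.unpair, n.unpair.2) && decide ((best n).1 * n.unpair.1.unpair.2 <
        n.unpair.1.unpair.1 * (best n).2)) with _ | _
    · exact le_rfl
    · simp only [Bool.and_eq_true, decide_eq_true_eq] at hc
      exact hc.2.le
  have hreach : ∀ u d : ℕ, (u : ℝ) < x * d → ∃ n, (u : ℝ) / d ≤ val n := by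
    intro u d hud
    obtain ⟨s, hs⟩ := (hRx (u, d)).1 hud
    have hd : 0 < d := by
      rcases Nat.eq_zero_or_pos d with h0 | h0
      · rw [h0, Nat.cast_zero, mul_zero] at hud
        exact absurd hud (not_lt.2 (Nat.cast_nonneg _))
      · exact h0
    refine ⟨Nat.pair (Nat.pair u d) s + 1, ?_⟩
    have h2 := (hinv (Nat.pair (Nat.pair u d) s + 1)).1
    simp only [hval]
    rw [div_le_div_iff₀ (by exact_mod_cast hd) (by exact_mod_cast h2)]
    norm_cast
    rw [hsucc]
    simp only [hstep, Nat.unpair_pair, hs, Bool.true_and]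
    rcases hc : decide ((best (Nat.pair (Nat.pair u d) s)).1 * d <
        u * (best (Nat.pair (Nat.pair u d) s)).2) with _ | _
    · simpa using hc
    · exact le_rfl
  have hlim : Tendsto val atTop (𝓝 x) := by
    refine tendsto_order.2 ⟨fun y hy => ?_, fun y hy => .of_forall fun n => (hvalx n).trans_lt hy⟩
    obtain ⟨a, b, -, hb, hab, hy'⟩ := exists_nat_div_lt hx (lt_mem_nhds hy)
    obtain ⟨n, hn⟩ := hreach a b ((div_lt_iff₀ (by exact_mod_cast hb)).1 hab)
    filter_upwards [eventually_ge_atTop n] with m hm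
    exact hy'.trans_le (hn.trans (hmono hm))
  -- Left-computability is right-computability of `-x`, hence the sign. `IsRecursiveRat` adds `1` to
  -- the denominator, hence `(best n).2 - 1`.
  refine ⟨fun n => -(((best n).1 : ℚ) / (best n).2), ⟨fun _ => 0, fun n => (best n).1,
    fun n => (best n).2 - 1, Computable.const _, by fun_prop,
    Primrec.pred.to_comp.comp (Computable.snd.comp hbestc), fun n => ?_⟩, fun n _ => ?_, ?_⟩
  · have h1 := (hinv n).1
    have : (((best n).2 - 1 : ℕ) : ℚ) + 1 = (best n).2 := by
      rw [Nat.cast_sub h1]; simp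
    rw [this]; simp [neg_div]
  · have := hvalx n
    push_cast
    exact neg_le_neg this
  · have := hlim.neg
    push_cast
    exact this

/-! ### Finite stages of the enumeration of the domain -/

open Nat.Partrec (Code)
open Nat.Partrec.Code (evaln eval)

/-- A code for a partial recursive function on strings. -/
def IsCodeOf (c : Code) (U : List Bool →. List Bool) : Prop :=
  ∀ p, eval c (Encodable.encode p) = (U p).map Encodable.encode

theorem exists_isCodeOf {U : List Bool →. List Bool} (hU : Partrec U) : ∃ c, IsCodeOf c U := by
  obtain ⟨c, hc⟩ := Nat.Partrec.Code.exists_code.1 hU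
  exact ⟨c, fun p => by rw [hc]; simp⟩

/-- The length of the program coded by `m`, if it halts within `t` steps. -/
def haltLength (c : Code) (t m : ℕ) : Option ℕ :=
  -- `decode₂` rejects numbers that are not the code of a string, so each program is counted once.
  (evaln t c m).bind fun _ => (Encodable.decode₂ (List Bool) m).map List.length

/-- The length of the output of the program coded by `m`, if it halts within `t` steps. -/
def outputLength (c : Code) (t m : ℕ) : Option ℕ :=
  (evaln t c m).bind fun o => (Encodable.decode (α := List Bool) o).map List.length

/-- `d ^ t` times the sum of `x ^ k * (u / d) ^ x` over the lengths `x` of the programs that halt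
within `t` steps. -/
def stageMoment (c : Code) (k t u d : ℕ) : ℕ :=
  ∑ m ∈ Finset.range t, ((haltLength c t m).map fun x => x ^ k * u ^ x * d ^ (t - x)).getD 0

/-- A string that is longer than all outputs of programs that halt within `t` steps. -/
def freshString (c : Code) (t : ℕ) : List Bool :=
  (List.range (∑ m ∈ Finset.range t, (outputLength c t m).getD 0 + 1)).map fun _ => true

theorem primrec_evaln_fixed (c : Code) : Primrec fun z : ℕ × ℕ => evaln z.1 c z.2 :=
  Nat.Partrec.Code.primrec_evaln.comp (f := fun a : (ℕ × Code) × ℕ => evaln a.1.1 a.1.2 a.2)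
    (g := fun z : ℕ × ℕ => ((z.1, c), z.2))
    ((Primrec.fst.pair (Primrec.const c)).pair Primrec.snd)

theorem primrec_haltLength (c : Code) : Primrec fun z : ℕ × ℕ => haltLength c z.1 z.2 := by
  refine Primrec.option_bind (primrec_evaln_fixed c) ?_
  exact (Primrec.option_map (Primrec.decode₂.comp (Primrec.snd.comp Primrec.fst))
    (Primrec.list_length.comp Primrec.snd).to₂).to₂

theorem primrec_outputLength (c : Code) : Primrec fun z : ℕ × ℕ => outputLength c z.1 z.2 := by
  refine Primrec.option_bind (primrec_evaln_fixed c) ?_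
  exact (Primrec.option_map (Primrec.decode.comp Primrec.snd)
    (Primrec.list_length.comp Primrec.snd).to₂).to₂

theorem primrec_stageMoment (c : Code) (k : ℕ) :
    Primrec fun z : ℕ × ℕ × ℕ => stageMoment c k z.1 z.2.1 z.2.2 := by
  refine primrec_sum_range (g := fun w : (ℕ × ℕ × ℕ) × ℕ => ((haltLength c w.1.1 w.2).map
    fun x => x ^ k * w.1.2.1 ^ x * w.1.2.2 ^ (w.1.1 - x)).getD 0) (by fun_prop) ?_
  refine Primrec.option_getD.comp (Primrec.option_map ((primrec_haltLength c).comp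
    (g := fun w : (ℕ × ℕ × ℕ) × ℕ => (w.1.1, w.2)) (by fun_prop)) ?_) (Primrec.const 0)
  have : Primrec fun y : ((ℕ × ℕ × ℕ) × ℕ) × ℕ =>
    y.2 ^ k * y.1.1.2.1 ^ y.2 * y.1.1.2.2 ^ (y.1.1.1 - y.2) := by fun_prop
  exact this.to₂

theorem primrec_freshString (c : Code) : Primrec (freshString c) := by
  have h : Primrec fun t : ℕ => ∑ m ∈ Finset.range t, (outputLength c t m).getD 0 :=
    primrec_sum_range (g := fun w : ℕ × ℕ => (outputLength c w.1 w.2).getD 0) (by fun_prop)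
      (Primrec.option_getD.comp (primrec_outputLength c) (Primrec.const 0))
  exact Primrec.list_map (Primrec.list_range.comp (Primrec.succ.comp h)) (Primrec₂.const true)

section Stage

variable {U : List Bool →. List Bool} {c : Code} {q : ℕ → List Bool}

theorem encode_injective (hq : Function.Injective q) :
    Function.Injective fun i => Encodable.encode (q i) :=
  Encodable.encode_injective.comp hq

/-- The indices of the programs that halt within `t` steps. -/
noncomputable def stage (c : Code) (hq : Function.Injective q) (t : ℕ) : Finset ℕ :=
  ((Finset.range t).preimage _ (encode_injective hq).injOn).filter
    fun i => (evaln t c (Encodable.encode (q i))).isSome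

theorem mem_stage {hq : Function.Injective q} {t i : ℕ} :
    i ∈ stage c hq t ↔ (evaln t c (Encodable.encode (q i))).isSome := by
  simp only [stage, Finset.mem_filter, Finset.mem_preimage, Finset.mem_range, and_iff_right_iff_imp]
  intro h
  obtain ⟨x, hx⟩ := Option.isSome_iff_exists.1 h
  exact Nat.Partrec.Code.evaln_bound hx

theorem monotone_stage (c : Code) (hq : Function.Injective q) : Monotone (stage c hq) := by
  intro s t hst i hi
  rw [mem_stage] at hi ⊢
  obtain ⟨x, hx⟩ := Option.isSome_iff_exists.1 hi
  exact Option.isSome_iff_exists.2 ⟨x, Nat.Partrec.Code.evaln_mono hst hx⟩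

theorem tendsto_stage (hc : IsCodeOf c U) (hq : Function.Injective q) (hqU : Set.range q = U.Dom) :
    Tendsto (stage c hq) atTop atTop := by
  refine tendsto_atTop_finset_of_monotone (monotone_stage c hq) fun i => ?_
  have hi : q i ∈ U.Dom := hqU ▸ Set.mem_range_self i
  obtain ⟨s, hs⟩ := Part.dom_iff_mem.1 hi
  have : Encodable.encode s ∈ eval c (Encodable.encode (q i)) := by
    rw [hc]; exact Part.mem_map _ hs
  obtain ⟨t, ht⟩ := Nat.Partrec.Code.evaln_complete.1 this
  exact ⟨t, mem_stage.2 (Option.isSome_iff_exists.2 ⟨_, ht⟩)⟩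

/-- The left side is computed from `c` alone. This removes the possibly non-recursive enumeration
`q` from every effective argument. -/
theorem stageMoment_eq_sum (hc : IsCodeOf c U) (hq : Function.Injective q)
    (hqU : Set.range q = U.Dom) (k t u d : ℕ) : stageMoment c k t u d =
      ∑ i ∈ stage c hq t, (q i).length ^ k * u ^ (q i).length * d ^ (t - (q i).length) := by
  rw [stageMoment, stage, Finset.sum_filter,
    ← Finset.sum_preimage _ (Finset.range t) (encode_injective hq).injOn]
  · refine Finset.sum_congr rfl fun i _ => ?_
    rcases h : evaln t c (Encodable.encode (q i)) with _ | x
    · simp [haltLength, h]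
    · simp [haltLength, h]
  · intro m _ hm
    have : haltLength c t m = none := by
      rcases h : evaln t c m with _ | x
      · simp [haltLength, h]
      · rcases hd : Encodable.decode₂ (List Bool) m with _ | p
        · simp [haltLength, hd]
        · exfalso
          have hp := Encodable.mem_decode₂.1 hd
          have h1 : x ∈ eval c m := Nat.Partrec.Code.evaln_sound h
          rw [← hp, hc] at h1
          have h2 : p ∈ U.Dom := by
            obtain ⟨s, hs, -⟩ := (Part.mem_map_iff _).1 h1
            exact Part.dom_iff_mem.2 ⟨s, hs⟩
          rw [← hqU] at h2
          obtain ⟨i, hi⟩ := h2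
          exact hm ⟨i, by simp only [hi, hp]⟩
    simp [this]

theorem length_lt_of_mem_stage {hq : Function.Injective q} {t i : ℕ} (hi : i ∈ stage c hq t) :
    (q i).length < t := by
  obtain ⟨x, hx⟩ := Option.isSome_iff_exists.1 (mem_stage.1 hi)
  exact (Encodable.length_le_encode _).trans_lt (Nat.Partrec.Code.evaln_bound hx)

theorem stageMoment_cast (hc : IsCodeOf c U) (hq : Function.Injective q)
    (hqU : Set.range q = U.Dom) (k t u : ℕ) {d : ℕ} (hd : 0 < d) : (stageMoment c k t u d : ℝ) =
      d ^ t * ∑ i ∈ stage c hq t, ((q i).length : ℝ) ^ k * ((u : ℝ) / d) ^ (q i).length := by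
  rw [stageMoment_eq_sum hc hq hqU, Finset.mul_sum]
  push_cast
  refine Finset.sum_congr rfl fun i hi => ?_
  have h : (d : ℝ) ^ t = d ^ (t - (q i).length) * d ^ (q i).length := by
    rw [← pow_add, Nat.sub_add_cancel (length_lt_of_mem_stage hi).le]
  have hd' : (d : ℝ) ≠ 0 := by positivity
  rw [h, div_pow]
  field_simp

theorem freshString_notMem (hc : IsCodeOf c U) {hq : Function.Injective q} {t i : ℕ}
    (hi : i ∈ stage c hq t) : freshString c t ∉ U (q i) := by
  intro hmem
  obtain ⟨x, hx⟩ := Option.isSome_iff_exists.1 (mem_stage.1 hi)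
  have h1 : x ∈ eval c (Encodable.encode (q i)) := Nat.Partrec.Code.evaln_sound hx
  rw [hc] at h1
  obtain ⟨s, hs, rfl⟩ := (Part.mem_map_iff _).1 h1
  have h2 : freshString c t = s := Part.mem_unique hmem hs
  have h3 : (outputLength c t (Encodable.encode (q i))).getD 0 = s.length := by
    simp [outputLength, hx]
  have h4 : s.length ≤ ∑ m ∈ Finset.range t, (outputLength c t m).getD 0 := by
    rw [← h3]
    exact Finset.single_le_sum (f := fun m => (outputLength c t m).getD 0) (fun _ _ => Nat.zero_le _)
      (Finset.mem_range.2 (Nat.Partrec.Code.evaln_bound hx))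
  have h5 := congrArg List.length h2
  simp only [freshString, List.length_map, List.length_range] at h5
  omega

end Stage

/-! ### Effective bounds for the variance at a stage -/

/-- Ceiling minus one and floor plus one, rather than floor and ceiling, keep both bounds strict. -/
theorem exists_nat_approx {x : ℝ} (hx : 0 < x) :
    ∃ lo hi : ℕ → ℕ, (∀ e, 0 < e → (lo e : ℝ) < x * e) ∧ (∀ e, x * e < (hi e : ℝ)) ∧
      Tendsto (fun e => (lo e : ℝ) / e) atTop (𝓝 x) ∧
      Tendsto (fun e => (hi e : ℝ) / e) atTop (𝓝 x) := by
  have hz : Tendsto (fun e : ℕ => (1 : ℝ) / e) atTop (𝓝 0) := tendsto_one_div_atTop_nhds_zero_nat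
  have h1 : ∀ e : ℕ, x * e < ((⌊x * e⌋₊ + 1 : ℕ) : ℝ) := fun e => by
    push_cast; exact Nat.lt_floor_add_one _
  have h2 : ∀ e : ℕ, ((⌊x * e⌋₊ + 1 : ℕ) : ℝ) ≤ x * e + 1 := fun e => by
    push_cast; have := Nat.floor_le (by positivity : 0 ≤ x * e); linarith
  have h3 : ∀ e : ℕ, 0 < e → ((⌈x * e⌉₊ - 1 : ℕ) : ℝ) < x * e := fun e he => by
    have hpos : 0 < x * e := by positivity
    rw [Nat.cast_sub (Nat.ceil_pos.2 hpos)]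
    have := Nat.ceil_lt_add_one hpos.le
    push_cast; linarith
  have h4 : ∀ e : ℕ, 0 < e → x * e - 1 ≤ ((⌈x * e⌉₊ - 1 : ℕ) : ℝ) := fun e he => by
    have hpos : 0 < x * e := by positivity
    rw [Nat.cast_sub (Nat.ceil_pos.2 hpos)]
    have := Nat.le_ceil (x * e)
    push_cast; linarith
  refine ⟨fun e => ⌈x * e⌉₊ - 1, fun e => ⌊x * e⌋₊ + 1, h3, h1, ?_, ?_⟩
  · refine tendsto_of_tendsto_of_tendsto_of_le_of_le' (g := fun e : ℕ => x - 1 / (e : ℝ))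
      (h := fun _ => x) (by simpa using tendsto_const_nhds.sub hz) tendsto_const_nhds ?_ ?_
    · filter_upwards [eventually_gt_atTop 0] with e he
      have he' : (0 : ℝ) < e := by exact_mod_cast he
      rw [le_div_iff₀ he', sub_mul, div_mul_cancel₀ _ he'.ne']
      exact h4 e he
    · filter_upwards [eventually_gt_atTop 0] with e he
      have he' : (0 : ℝ) < e := by exact_mod_cast he
      rw [div_le_iff₀ he']
      exact (h3 e he).le
  · refine tendsto_of_tendsto_of_tendsto_of_le_of_le' (g := fun _ => x)
      (h := fun e : ℕ => x + 1 / (e : ℝ)) tendsto_const_nhds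
      (by simpa using tendsto_const_nhds.add hz) ?_ ?_
    · filter_upwards [eventually_gt_atTop 0] with e he
      have he' : (0 : ℝ) < e := by exact_mod_cast he
      rw [le_div_iff₀ he']
      exact (h1 e).le
    · filter_upwards [eventually_gt_atTop 0] with e he
      have he' : (0 : ℝ) < e := by exact_mod_cast he
      rw [div_le_iff₀ he', add_mul, div_mul_cancel₀ _ he'.ne']
      exact h2 e

section Bounds

variable {x : ℕ → ℕ} {F : Finset ℕ} {b γ : ℝ}

/-- The moments of lengths over a finite set of indices with base `X`. -/
noncomputable def lengthMoment (x : ℕ → ℕ) (F : Finset ℕ) (k : ℕ) (X : ℝ) : ℝ :=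
  ∑ i ∈ F, (x i : ℝ) ^ k * X ^ x i

theorem lengthMoment_nonneg (x : ℕ → ℕ) (F : Finset ℕ) (k : ℕ) {X : ℝ} (hX : 0 ≤ X) :
    0 ≤ lengthMoment x F k X :=
  Finset.sum_nonneg fun i _ => by positivity

theorem lengthMoment_mono (x : ℕ → ℕ) (F : Finset ℕ) (k : ℕ) {X Y : ℝ} (hX : 0 ≤ X) (h : X ≤ Y) :
    lengthMoment x F k X ≤ lengthMoment x F k Y :=
  Finset.sum_le_sum fun i _ => by gcongr

theorem continuous_lengthMoment (x : ℕ → ℕ) (F : Finset ℕ) (k : ℕ) :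
    Continuous (lengthMoment x F k) := by
  unfold lengthMoment; fun_prop

theorem finVar_eq_lengthMoment (x : ℕ → ℕ) (F : Finset ℕ) (b : ℝ) :
    finVar (fun i => (x i : ℝ)) (fun i => b ^ x i) F =
      (lengthMoment x F 2 b * lengthMoment x F 0 b - lengthMoment x F 1 b ^ 2) /
        lengthMoment x F 0 b ^ 2 := by
  simp [finVar, lengthMoment]

theorem lengthMoment_zero_pos (hb : 0 < b) (hF : F.Nonempty) : 0 < lengthMoment x F 0 b :=
  Finset.sum_pos (fun i _ => by positivity) hF

theorem lengthMoment_sq_le (x : ℕ → ℕ) (F : Finset ℕ) (hb : 0 ≤ b) :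
    lengthMoment x F 1 b ^ 2 ≤ lengthMoment x F 2 b * lengthMoment x F 0 b := by
  have h := sq_sum_le (y := fun i => (x i : ℝ)) (w := fun i => b ^ x i) (fun i => by positivity) F
  simpa [lengthMoment] using h

/-- Interval arithmetic with common denominator `e`: moments increase with the base, so the positive
term is taken at `v / e` below `b`, and the subtracted square and the normalisation at `v' / e`
above `b`. By continuity fine enough bounds succeed. -/
theorem lt_finVar_iff (hb : 0 < b) (hγ : 0 < γ) (u d : ℕ) :
    (u : ℝ) < γ * finVar (fun i => (x i : ℝ)) (fun i => b ^ x i) F * d ↔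
      ∃ e v v' g : ℕ, (v : ℝ) < b * e ∧ b * e < (v' : ℝ) ∧ (g : ℝ) < γ * e ∧
        u * e * lengthMoment x F 0 (v' / e) ^ 2 + d * g * lengthMoment x F 1 (v' / e) ^ 2 <
          d * g * (lengthMoment x F 2 (v / e) * lengthMoment x F 0 (v / e)) := by
  rw [finVar_eq_lengthMoment]
  constructor
  · intro h
    have hF : F.Nonempty := by
      rw [Finset.nonempty_iff_ne_empty]
      rintro rfl
      simp [lengthMoment] at h
      linarith [(Nat.cast_nonneg u : (0 : ℝ) ≤ u)]
    have h0 := lengthMoment_zero_pos (x := x) hb hF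
    have h1 : u * lengthMoment x F 0 b ^ 2 + d * γ * lengthMoment x F 1 b ^ 2 <
        d * γ * (lengthMoment x F 2 b * lengthMoment x F 0 b) := by
      rw [mul_div_assoc', div_mul_eq_mul_div, lt_div_iff₀ (by positivity)] at h
      linarith
    obtain ⟨lo, hi, hlo, hhi, hlo', hhi'⟩ := exists_nat_approx hb
    obtain ⟨glo, -, hglo, -, hglo', -⟩ := exists_nat_approx hγ
    have c := fun k => (continuous_lengthMoment x F k).tendsto b
    have t1 : Tendsto (fun e : ℕ => u * lengthMoment x F 0 (hi e / e) ^ 2 +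
        d * ((glo e : ℝ) / e) * lengthMoment x F 1 (hi e / e) ^ 2) atTop _ :=
      ((((c 0).comp hhi').pow 2).const_mul (u : ℝ)).add
        ((hglo'.const_mul (d : ℝ)).mul (((c 1).comp hhi').pow 2))
    have t2 : Tendsto (fun e : ℕ => d * ((glo e : ℝ) / e) *
        (lengthMoment x F 2 (lo e / e) * lengthMoment x F 0 (lo e / e))) atTop _ :=
      (hglo'.const_mul (d : ℝ)).mul (((c 2).comp hlo').mul ((c 0).comp hlo'))
    obtain ⟨e, he, hlt⟩ := ((eventually_gt_atTop 0).and (t1.eventually_lt t2 h1)).exists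
    have he' : (0 : ℝ) < e := by exact_mod_cast he
    refine ⟨e, lo e, hi e, glo e, hlo e he, hhi e, hglo e he, ?_⟩
    have h2 := mul_lt_mul_of_pos_left hlt he'
    have h3 : (e : ℝ) * (glo e / e) = glo e := mul_div_cancel₀ _ he'.ne'
    calc _ = _ := ?_
      _ < _ := h2
      _ = _ := ?_
    all_goals
      generalize (glo e : ℝ) / e = r at h3
      rw [← h3]
      ring
  · rintro ⟨e, v, v', g, h1, h2, h3, h4⟩
    have he : (0 : ℝ) < e := by
      rcases Nat.eq_zero_or_pos e with rfl | he
      · simp at h1; linarith [(Nat.cast_nonneg v : (0 : ℝ) ≤ v)]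
      · exact_mod_cast he
    have hX : (v : ℝ) / e ≤ b := (div_le_iff₀ he).2 h1.le
    have hY : b ≤ (v' : ℝ) / e := (le_div_iff₀ he).2 h2.le
    have hX0 : 0 ≤ (v : ℝ) / e := by positivity
    have m0 := lengthMoment_mono x F 0 hX0 hX
    have m2 := lengthMoment_mono x F 2 hX0 hX
    have n0 := lengthMoment_mono x F 0 hb.le hY
    have n1 := lengthMoment_mono x F 1 hb.le hY
    have p0 := lengthMoment_nonneg x F 0 hX0
    have p2 := lengthMoment_nonneg x F 2 hX0
    have q0 := lengthMoment_nonneg x F 0 hb.le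
    have q1 := lengthMoment_nonneg x F 1 hb.le
    have q2 := lengthMoment_nonneg x F 2 hb.le
    have h5 : u * e * lengthMoment x F 0 b ^ 2 + d * g * lengthMoment x F 1 b ^ 2 <
        d * g * (lengthMoment x F 2 b * lengthMoment x F 0 b) :=
      calc _ ≤ u * e * lengthMoment x F 0 (v' / e) ^ 2 + d * g * lengthMoment x F 1 (v' / e) ^ 2 := by
            gcongr
        _ < _ := h4
        _ ≤ _ := by gcongr
    have hpos : 0 < lengthMoment x F 0 b := by
      refine lt_of_le_of_ne q0 fun h0 => ?_
      rw [← h0] at h5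
      have : 0 ≤ (d : ℝ) * g * lengthMoment x F 1 b ^ 2 := by positivity
      simp at h5
      linarith
    have hcs := lengthMoment_sq_le x F hb.le
    have h6 : d * g * (lengthMoment x F 2 b * lengthMoment x F 0 b - lengthMoment x F 1 b ^ 2) ≤
        d * (γ * e) * (lengthMoment x F 2 b * lengthMoment x F 0 b - lengthMoment x F 1 b ^ 2) := by
      have := sub_nonneg.2 hcs
      gcongr
    rw [mul_div_assoc', div_mul_eq_mul_div, lt_div_iff₀ (by positivity)]
    refine lt_of_mul_lt_mul_right ?_ he.le
    linarith

theorem finVar_lt_iff (hb : 0 < b) (hγ : 0 < γ) (u d : ℕ) :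
    (F.Nonempty ∧ γ * finVar (fun i => (x i : ℝ)) (fun i => b ^ x i) F * d < u) ↔
      ∃ e v v' g : ℕ, (v : ℝ) < b * e ∧ b * e < (v' : ℝ) ∧ γ * e < (g : ℝ) ∧
        d * g * (lengthMoment x F 2 (v' / e) * lengthMoment x F 0 (v' / e)) <
        u * e * lengthMoment x F 0 (v / e) ^ 2 + d * g * lengthMoment x F 1 (v / e) ^ 2 := by
  rw [finVar_eq_lengthMoment]
  constructor
  · rintro ⟨hF, h⟩
    have h0 := lengthMoment_zero_pos (x := x) hb hF
    have h1 : d * γ * (lengthMoment x F 2 b * lengthMoment x F 0 b) <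
        u * lengthMoment x F 0 b ^ 2 + d * γ * lengthMoment x F 1 b ^ 2 := by
      rw [mul_div_assoc', div_mul_eq_mul_div, div_lt_iff₀ (by positivity)] at h
      linarith
    obtain ⟨lo, hi, hlo, hhi, hlo', hhi'⟩ := exists_nat_approx hb
    obtain ⟨-, ghi, -, hghi, -, hghi'⟩ := exists_nat_approx hγ
    have c := fun k => (continuous_lengthMoment x F k).tendsto b
    have t1 : Tendsto (fun e : ℕ => u * lengthMoment x F 0 (lo e / e) ^ 2 +
        d * ((ghi e : ℝ) / e) * lengthMoment x F 1 (lo e / e) ^ 2) atTop _ :=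
      ((((c 0).comp hlo').pow 2).const_mul (u : ℝ)).add
        ((hghi'.const_mul (d : ℝ)).mul (((c 1).comp hlo').pow 2))
    have t2 : Tendsto (fun e : ℕ => d * ((ghi e : ℝ) / e) *
        (lengthMoment x F 2 (hi e / e) * lengthMoment x F 0 (hi e / e))) atTop _ :=
      (hghi'.const_mul (d : ℝ)).mul (((c 2).comp hhi').mul ((c 0).comp hhi'))
    obtain ⟨e, he, hlt⟩ := ((eventually_gt_atTop 0).and (t2.eventually_lt t1 h1)).exists
    have he' : (0 : ℝ) < e := by exact_mod_cast he
    refine ⟨e, lo e, hi e, ghi e, hlo e he, hhi e, hghi e, ?_⟩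
    have h2 := mul_lt_mul_of_pos_left hlt he'
    have h3 : (e : ℝ) * (ghi e / e) = ghi e := mul_div_cancel₀ _ he'.ne'
    calc _ = _ := ?_
      _ < _ := h2
      _ = _ := ?_
    all_goals
      generalize (ghi e : ℝ) / e = r at h3
      rw [← h3]
      ring
  · rintro ⟨e, v, v', g, h1, h2, h3, h4⟩
    have he : (0 : ℝ) < e := by
      rcases Nat.eq_zero_or_pos e with rfl | he
      · simp at h1; linarith [(Nat.cast_nonneg v : (0 : ℝ) ≤ v)]
      · exact_mod_cast he
    have hF : F.Nonempty := by
      rw [Finset.nonempty_iff_ne_empty]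
      -- For empty `F` the right side would read `0 < 0`, while the variance takes the default value
      -- `0 / 0 = 0`; this is why nonemptiness appears in the equivalence.
      rintro rfl
      simp [lengthMoment] at h4
    have hX : (v : ℝ) / e ≤ b := (div_le_iff₀ he).2 h1.le
    have hY : b ≤ (v' : ℝ) / e := (le_div_iff₀ he).2 h2.le
    have hX0 : 0 ≤ (v : ℝ) / e := by positivity
    have m0 := lengthMoment_mono x F 0 hX0 hX
    have m1 := lengthMoment_mono x F 1 hX0 hX
    have n0 := lengthMoment_mono x F 0 hb.le hY
    have n2 := lengthMoment_mono x F 2 hb.le hY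
    have p0 := lengthMoment_nonneg x F 0 hX0
    have p1 := lengthMoment_nonneg x F 1 hX0
    have q0 := lengthMoment_nonneg x F 0 hb.le
    have q2 := lengthMoment_nonneg x F 2 hb.le
    have q2' := lengthMoment_nonneg x F 2 (hb.le.trans hY)
    have h5 : d * g * (lengthMoment x F 2 b * lengthMoment x F 0 b) <
        u * e * lengthMoment x F 0 b ^ 2 + d * g * lengthMoment x F 1 b ^ 2 :=
      calc _ ≤ d * g * (lengthMoment x F 2 (v' / e) * lengthMoment x F 0 (v' / e)) := by gcongr
        _ < _ := h4
        _ ≤ _ := by gcongr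
    have hpos := lengthMoment_zero_pos (x := x) hb hF
    have hcs := lengthMoment_sq_le x F hb.le
    have h6 : d * (γ * e) * (lengthMoment x F 2 b * lengthMoment x F 0 b - lengthMoment x F 1 b ^ 2) ≤
        d * g * (lengthMoment x F 2 b * lengthMoment x F 0 b - lengthMoment x F 1 b ^ 2) := by
      have := sub_nonneg.2 hcs
      gcongr
    refine ⟨hF, ?_⟩
    rw [mul_div_assoc', div_mul_eq_mul_div, div_lt_iff₀ (by positivity)]
    refine lt_of_mul_lt_mul_right ?_ he.le
    linarith

end Bounds

end AIT

/-! ### Binary expansions and the specific heat of a stage -/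

namespace AIT

open Nat.Partrec (Code)

/-! ### Binary expansions -/

/-- The `n` low-order bits of `z`, most significant first. -/
def bitList (n z : ℕ) : List Bool :=
  (List.range n).map fun i => decide (z / 2 ^ (n - 1 - i) % 2 = 1)

/-- The number with binary expansion `l`. -/
def bitsValue (l : List Bool) : ℕ := l.foldl (fun a b => 2 * a + b.toNat) 0

@[simp]
theorem length_bitList (n z : ℕ) : (bitList n z).length = n := by simp [bitList]

theorem bitList_succ (n z : ℕ) : bitList (n + 1) z = bitList n (z / 2) ++ [decide (z % 2 = 1)] := by
  rw [bitList, List.range_succ, List.map_append, bitList]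
  congr 1
  · refine List.map_congr_left fun i hi => ?_
    have hi := List.mem_range.1 hi
    have : n + 1 - 1 - i = (n - 1 - i) + 1 := by omega
    rw [this, pow_succ', ← Nat.div_div_eq_div_mul]
  · simp

theorem bitsValue_append_singleton (l : List Bool) (b : Bool) :
    bitsValue (l ++ [b]) = 2 * bitsValue l + b.toNat := by
  simp [bitsValue]

theorem bitsValue_bitList (n z : ℕ) : bitsValue (bitList n z) = z % 2 ^ n := by
  induction n generalizing z with
  | zero => simp [bitList, bitsValue, Nat.mod_one]
  | succ n ih =>
    rw [bitList_succ, bitsValue_append_singleton, ih, pow_succ', Nat.mod_mul]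
    rcases Nat.mod_two_eq_zero_or_one z with h | h
    · simp [h]
    · simp [h]; omega

theorem bitsValue_header (m : ℕ) (v : List Bool) :
    bitsValue (List.replicate m false ++ true :: v) = 2 ^ v.length + bitsValue v := by
  have h0 : ∀ m : ℕ, List.foldl (fun a b => 2 * a + Bool.toNat b) 0 (List.replicate m false) = 0 := by
    intro m
    induction m with
    | zero => rfl
    | succ m ih => simpa [List.replicate_succ] using ih
  have h1 : ∀ (v : List Bool) (a : ℕ), List.foldl (fun a b => 2 * a + Bool.toNat b) a v =
      a * 2 ^ v.length + List.foldl (fun a b => 2 * a + Bool.toNat b) 0 v := by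
    intro v
    induction v using List.reverseRecOn with
    | nil => simp
    | append_singleton v b ih =>
      intro a
      simp only [List.foldl_append, List.foldl_cons, List.foldl_nil, List.length_append,
        List.length_singleton]
      rw [ih a]; ring
  rw [bitsValue, List.foldl_append, h0, List.foldl_cons, h1]
  simp [bitsValue]

theorem firstBits_eq_bitList {x : ℝ} (hx : 0 ≤ x) (n : ℕ) :
    firstBits x n = bitList n ⌊x * 2 ^ n⌋₊ := by
  refine List.map_congr_left fun i hi => ?_
  have hi := List.mem_range.1 hi
  have h1 : ⌊x * 2 ^ n⌋₊ / 2 ^ (n - 1 - i) = ⌊x * 2 ^ (i + 1)⌋₊ := by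
    have h2 : x * 2 ^ (i + 1) = x * 2 ^ n / ((2 ^ (n - 1 - i) : ℕ) : ℝ) := by
      have : (2 : ℝ) ^ n = 2 ^ (i + 1) * 2 ^ (n - 1 - i) := by
        rw [← pow_add]; congr 1; omega
      push_cast
      rw [this]; field_simp
    rw [h2, Nat.floor_div_natCast]
  have h3 : ⌊Int.fract x * 2 ^ (i + 1)⌋ = ⌊x * 2 ^ (i + 1)⌋ - ⌊x⌋ * 2 ^ (i + 1) := by
    rw [← Int.floor_sub_intCast]
    congr 1
    rw [Int.fract]; push_cast; ring
  have h4 : ((⌊x * 2 ^ (i + 1)⌋₊ : ℕ) : ℤ) = ⌊x * 2 ^ (i + 1)⌋ :=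
    Int.natCast_floor_eq_floor (by positivity)
  -- Removing the integer part changes the scaled floor by an even number, so the bit is unaffected.
  have h5 : ⌊x⌋ * 2 ^ (i + 1) = 2 * (⌊x⌋ * 2 ^ i) := by ring
  rw [h1, h3, ← h4, h5]
  congr 1
  rw [eq_iff_iff]
  omega

/-- The integer part is a constant that can be built into a machine, so the first `n` bits suffice
to recover the scaled floor. -/
theorem floor_eq_bitsValue_firstBits {x : ℝ} (hx : 0 ≤ x) (n : ℕ) :
    ⌊x⌋₊ * 2 ^ n + bitsValue (firstBits x n) = ⌊x * 2 ^ n⌋₊ := by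
  rw [firstBits_eq_bitList hx, bitsValue_bitList]
  have h1 : ⌊x⌋₊ = ⌊x * 2 ^ n⌋₊ / 2 ^ n := by
    have h2 : x = x * 2 ^ n / ((2 ^ n : ℕ) : ℝ) := by push_cast; field_simp
    conv_lhs => rw [h2, Nat.floor_div_natCast]
  rw [h1, mul_comm]
  exact Nat.div_add_mod _ _

@[simp]
theorem length_firstBits (x : ℝ) (n : ℕ) : (firstBits x n).length = n := by simp [firstBits]

@[fun_prop]
theorem primrec_length {α β : Type*} [Primcodable α] [Primcodable β] {f : α → List β}
    (hf : Primrec f) : Primrec fun a => (f a).length :=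
  Primrec.list_length.comp hf

@[fun_prop]
theorem primrec_idxOf_true {α : Type*} [Primcodable α] {f : α → List Bool}
    (hf : Primrec f) : Primrec fun a => (f a).idxOf true :=
  Primrec.list_idxOf.comp (Primrec.const true) hf

@[fun_prop]
theorem primrec_bitsValue {α : Type*} [Primcodable α] {f : α → List Bool} (hf : Primrec f) :
    Primrec fun a => bitsValue (f a) := by
  have h : Primrec fun z : ℕ × Bool => 2 * z.1 + z.2.toNat :=
    primrec_add (by fun_prop) ((Primrec.dom_bool Bool.toNat).comp Primrec.snd)
  exact Primrec.list_foldl hf (Primrec.const 0) (h.comp Primrec.snd).to₂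

theorem primrec_bitList : Primrec fun z : ℕ × ℕ => bitList z.1 z.2 := by
  refine Primrec.list_map (Primrec.list_range.comp Primrec.fst) ?_
  have : Primrec fun z : (ℕ × ℕ) × ℕ => decide (z.1.2 / 2 ^ (z.1.1 - 1 - z.2) % 2 = 1) :=
    (Primrec.eq.comp (f := fun z : (ℕ × ℕ) × ℕ => z.1.2 / 2 ^ (z.1.1 - 1 - z.2) % 2)
      (g := fun _ => 1) (by fun_prop) (by fun_prop)).decide
  exact this.to₂

/-! ### Optimal computers -/

/-- Simulating the computer whose only program is the empty string, with output `s`, shows that the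
infimum is over a nonempty set. -/
theorem IsOptimal.exists_program {U : List Bool →. List Bool} (hU : IsOptimal U) (s : List Bool) :
    ∃ p, s ∈ U p ∧ p.length = complexity U s := by
  have hC : IsComputer fun p => Part.ofOption (if p = [] then some s else none) := by
    constructor
    · exact (Primrec.ite (Primrec.eq.comp Primrec.id (Primrec.const [])) (Primrec.const (some s))
        (Primrec.const none)).to_comp.ofOption
    · have key : ∀ p ∈ (PFun.Dom fun p : List Bool =>
          Part.ofOption (if p = [] then some s else none)), p = [] := by
        intro p hp
        by_contra hcon
        simp [PFun.Dom, hcon] at hp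
      exact fun p hp p' hp' _ => (key p hp).trans (key p' hp').symm
  obtain ⟨k, hk⟩ := hU.2 _ hC
  obtain ⟨p, hp, -⟩ := hk [] s (by simp)
  exact Nat.sInf_mem (s := {l : ℕ | ∃ p : List Bool, s ∈ U p ∧ p.length = l}) ⟨_, p, hp, rfl⟩

theorem complexity_le {U : List Bool →. List Bool} {p s : List Bool} (h : s ∈ U p) :
    complexity U s ≤ p.length :=
  Nat.sInf_le ⟨p, h, rfl⟩

/-! ### The specific heat of finite sets of programs -/

/-- The specific heat of a finite set of programs. -/
noncomputable def finHeat (q : ℕ → List Bool) (T : ℝ) (F : Finset ℕ) : ℝ :=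
  Real.log 2 / T ^ 2 *
    finVar (fun i => ((q i).length : ℝ)) (fun i => ((2 : ℝ) ^ (-(1 / T))) ^ (q i).length) F

theorem finHeat_nonneg (q : ℕ → List Bool) (T : ℝ) (F : Finset ℕ) : 0 ≤ finHeat q T F :=
  mul_nonneg (div_nonneg (Real.log_nonneg (by norm_num)) (sq_nonneg T))
    (finVar_nonneg (fun i => by positivity) F)

@[fun_prop]
theorem primrec_stageMoment_comp {α : Type*} [Primcodable α] {c : Code} {k : ℕ} {f g h : α → ℕ}
    (hf : Primrec f) (hg : Primrec g) (hh : Primrec h) :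
    Primrec fun a => stageMoment c k (f a) (g a) (h a) :=
  (primrec_stageMoment c k).comp (hf.pair (hg.pair hh))

section Stages

variable {U : List Bool →. List Bool} {c : Code} {q : ℕ → List Bool} {T : ℝ}

theorem isRE_lt_finHeat_stage (hc : IsCodeOf c U) (hq : Function.Injective q)
    (hqU : Set.range q = U.Dom) (hT : 0 < T) (hTc : IsComputableReal T) :
    IsRE fun z : ℕ × ℕ × ℕ => (z.2.1 : ℝ) < finHeat q T (stage c hq z.1) * z.2.2 := by
  have hlo := hTc.isLowerRE.two_rpow_neg_inv hT
  have hhi := hTc.isUpperRE.two_rpow_neg_inv hT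
  have hγ := isLowerRE_log_two_div_sq hT hTc.isUpperRE
  have hre : IsRE fun x : (ℕ × ℕ × ℕ) × ℕ × ℕ × ℕ × ℕ =>
      ((((x.2.2.1 : ℝ) < (2 : ℝ) ^ (-(1 / T)) * x.2.1) ∧
      ((2 : ℝ) ^ (-(1 / T)) * x.2.1 < x.2.2.2.1)) ∧ (x.2.2.2.2 : ℝ) < Real.log 2 / T ^ 2 * x.2.1) ∧
      x.1.2.1 * x.2.1 * stageMoment c 0 x.1.1 x.2.2.2.1 x.2.1 ^ 2 +
        x.1.2.2 * x.2.2.2.2 * stageMoment c 1 x.1.1 x.2.2.2.1 x.2.1 ^ 2 <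
      x.1.2.2 * x.2.2.2.2 * (stageMoment c 2 x.1.1 x.2.2.1 x.2.1 *
        stageMoment c 0 x.1.1 x.2.2.1 x.2.1) :=
    (((hlo.comp (f := fun x : (ℕ × ℕ × ℕ) × ℕ × ℕ × ℕ × ℕ => (x.2.2.1, x.2.1)) (by fun_prop)).and
      (hhi.comp (f := fun x : (ℕ × ℕ × ℕ) × ℕ × ℕ × ℕ × ℕ => (x.2.2.2.1, x.2.1)) (by fun_prop))).and
      (hγ.comp (f := fun x : (ℕ × ℕ × ℕ) × ℕ × ℕ × ℕ × ℕ => (x.2.2.2.2, x.2.1)) (by fun_prop))).and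
      (IsRE.natLt (by fun_prop) (by fun_prop))
  refine hre.exists.of_iff fun ⟨t, u, d⟩ => ?_
  have hlog : 0 < Real.log 2 := Real.log_pos (by norm_num)
  dsimp only
  rw [finHeat, lt_finVar_iff (two_rpow_neg_inv_pos T) (by positivity)]
  simp only [Prod.exists]
  refine exists_congr fun e => exists_congr fun v => exists_congr fun v' => exists_congr fun g => ?_
  rw [and_assoc, and_assoc]
  refine and_congr_right fun h1 => and_congr_right fun _ => and_congr_right fun _ => ?_
  have he : 0 < e := by
    rcases Nat.eq_zero_or_pos e with rfl | he
    · simp at h1; linarith [(Nat.cast_nonneg v : (0 : ℝ) ≤ v)]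
    · exact he
  -- Each integer moment is `e ^ t` times the real one, and both sides are quadratic in the moments.
  have hpos : (0 : ℝ) < ((e : ℝ) ^ t) ^ 2 := by positivity
  rw [← mul_lt_mul_iff_right₀ hpos, ← Nat.cast_lt (α := ℝ)]
  push_cast
  simp only [stageMoment_cast hc hq hqU _ _ _ he, ← lengthMoment.eq_1 (fun i => (q i).length)]
  refine iff_of_eq (congrArg₂ _ ?_ ?_) <;> ring

theorem isRE_finHeat_stage_lt (hc : IsCodeOf c U) (hq : Function.Injective q)
    (hqU : Set.range q = U.Dom) (hT : 0 < T) (hTc : IsComputableReal T) :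
    IsRE fun z : ℕ × ℕ × ℕ => (stage c hq z.1).Nonempty ∧
      finHeat q T (stage c hq z.1) * z.2.2 < z.2.1 := by
  have hlo := hTc.isLowerRE.two_rpow_neg_inv hT
  have hhi := hTc.isUpperRE.two_rpow_neg_inv hT
  have hγ := isUpperRE_log_two_div_sq hT hTc.isLowerRE
  have hre : IsRE fun x : (ℕ × ℕ × ℕ) × ℕ × ℕ × ℕ × ℕ =>
      ((((x.2.2.1 : ℝ) < (2 : ℝ) ^ (-(1 / T)) * x.2.1) ∧
      ((2 : ℝ) ^ (-(1 / T)) * x.2.1 < x.2.2.2.1)) ∧ Real.log 2 / T ^ 2 * x.2.1 < x.2.2.2.2) ∧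
      x.1.2.2 * x.2.2.2.2 * (stageMoment c 2 x.1.1 x.2.2.2.1 x.2.1 *
        stageMoment c 0 x.1.1 x.2.2.2.1 x.2.1) <
      x.1.2.1 * x.2.1 * stageMoment c 0 x.1.1 x.2.2.1 x.2.1 ^ 2 +
        x.1.2.2 * x.2.2.2.2 * stageMoment c 1 x.1.1 x.2.2.1 x.2.1 ^ 2 :=
    (((hlo.comp (f := fun x : (ℕ × ℕ × ℕ) × ℕ × ℕ × ℕ × ℕ => (x.2.2.1, x.2.1)) (by fun_prop)).and
      (hhi.comp (f := fun x : (ℕ × ℕ × ℕ) × ℕ × ℕ × ℕ × ℕ => (x.2.2.2.1, x.2.1)) (by fun_prop))).and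
      (hγ.comp (f := fun x : (ℕ × ℕ × ℕ) × ℕ × ℕ × ℕ × ℕ => (x.2.2.2.2, x.2.1)) (by fun_prop))).and
      (IsRE.natLt (by fun_prop) (by fun_prop))
  refine hre.exists.of_iff fun ⟨t, u, d⟩ => ?_
  have hlog : 0 < Real.log 2 := Real.log_pos (by norm_num)
  dsimp only
  rw [finHeat, finVar_lt_iff (two_rpow_neg_inv_pos T) (by positivity)]
  simp only [Prod.exists]
  refine exists_congr fun e => exists_congr fun v => exists_congr fun v' => exists_congr fun g => ?_
  rw [and_assoc, and_assoc]
  refine and_congr_right fun h1 => and_congr_right fun _ => and_congr_right fun _ => ?_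
  have he : 0 < e := by
    rcases Nat.eq_zero_or_pos e with rfl | he
    · simp at h1; linarith [(Nat.cast_nonneg v : (0 : ℝ) ≤ v)]
    · exact he
  have hpos : (0 : ℝ) < ((e : ℝ) ^ t) ^ 2 := by positivity
  rw [← mul_lt_mul_iff_right₀ hpos, ← Nat.cast_lt (α := ℝ)]
  push_cast
  simp only [stageMoment_cast hc hq hqU _ _ _ he, ← lengthMoment.eq_1 (fun i => (q i).length)]
  refine iff_of_eq (congrArg₂ _ ?_ ?_) <;> ring

theorem tendsto_finHeat_stage (hc : IsCodeOf c U) (hq : Function.Injective q)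
    (hqU : Set.range q = U.Dom) (hT : 0 < T) (hT1 : T < 1)
    (hs : Summable fun i => (1 / 2 : ℝ) ^ (q i).length) :
    Tendsto (fun t => finHeat q T (stage c hq t)) atTop (𝓝 (specificHeat q T)) := by
  rw [specificHeat_eq hs hT hT1]
  have h := fun k => summable_moment hs k (two_rpow_neg_inv_pos T).le (two_rpow_neg_inv_lt_half hT hT1)
  exact (tendsto_finVar (tendsto_stage hc hq hqU) (fun i => by positivity) (by simpa using h 0)
    (by simpa using h 1) (h 2)).const_mul _

/-- The second moment of the lengths of the programs outside `F`. -/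
noncomputable def tailMoment (q : ℕ → List Bool) (T : ℝ) (F : Finset ℕ) : ℝ :=
  ∑' i : {i // i ∉ F}, ((q i).length : ℝ) ^ 2 * ((2 : ℝ) ^ (-(1 / T))) ^ (q i).length

/-- The threshold `t₀` is not computed. It is a fixed number built into the algorithms below, which
work with stages `t + t₀` only. -/
theorem exists_finHeat_stage_bounds (hc : IsCodeOf c U) (hq : Function.Injective q)
    (hqU : Set.range q = U.Dom) (hT : 0 < T) (hT1 : T < 1)
    (hs : Summable fun i => (1 / 2 : ℝ) ^ (q i).length) :
    ∃ (t₀ : ℕ) (k K : ℝ), 0 < k ∧ 0 < K ∧ ∀ t, t₀ ≤ t → (stage c hq t).Nonempty ∧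
      (∀ i ∉ stage c hq t, 1 ≤ (q i).length) ∧
      finHeat q T (stage c hq t) + k * tailMoment q T (stage c hq t) ≤ specificHeat q T ∧
      specificHeat q T ≤ finHeat q T (stage c hq t) + K * tailMoment q T (stage c hq t) := by
  have h := fun k => summable_moment hs k (two_rpow_neg_inv_pos T).le (two_rpow_neg_inv_lt_half hT hT1)
  obtain ⟨B, k, K, hBne, hk, hK, hB1, hB⟩ := exists_finVar_bounds
    (y := fun i => ((q i).length : ℝ)) (w := fun i => ((2 : ℝ) ^ (-(1 / T))) ^ (q i).length)
    (fun i => by positivity) (fun i => by positivity)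
    (tendsto_natCast_atTop_atTop.comp (tendsto_length_atTop hs)) (by simpa using h 0)
    (by simpa using h 1) (h 2)
  obtain ⟨t₀, ht₀⟩ := eventually_atTop.1 ((tendsto_stage hc hq hqU).eventually_ge_atTop B)
  have hlog : 0 < Real.log 2 := Real.log_pos (by norm_num)
  have hγ : 0 < Real.log 2 / T ^ 2 := by positivity
  refine ⟨t₀, Real.log 2 / T ^ 2 * k, Real.log 2 / T ^ 2 * K, by positivity, by positivity,
    fun t ht => ⟨hBne.mono (ht₀ t ht), fun i hi => ?_, ?_, ?_⟩⟩
  · exact_mod_cast hB1 i fun hiB => hi (ht₀ t ht hiB)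
  · rw [finHeat, specificHeat_eq hs hT hT1, mul_assoc, ← mul_add]
    exact mul_le_mul_of_nonneg_left (hB _ (ht₀ t ht)).1 hγ.le
  · rw [finHeat, specificHeat_eq hs hT hT1, mul_assoc, ← mul_add]
    exact mul_le_mul_of_nonneg_left (hB _ (ht₀ t ht)).2 hγ.le

theorem le_tailMoment (hT : 0 < T) (hT1 : T < 1)
    (hs : Summable fun i => (1 / 2 : ℝ) ^ (q i).length) {F : Finset ℕ} {i : ℕ} (hi : i ∉ F) :
    ((q i).length : ℝ) ^ 2 * ((2 : ℝ) ^ (-(1 / T))) ^ (q i).length ≤ tailMoment q T F :=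
  ((summable_moment hs 2 (two_rpow_neg_inv_pos T).le
    (two_rpow_neg_inv_lt_half hT hT1)).subtype _).le_tsum (⟨i, hi⟩ : {i // i ∉ F})
    fun _ _ => mul_nonneg (sq_nonneg _) (pow_nonneg (two_rpow_neg_inv_pos T).le _)

theorem tailMoment_nonneg (q : ℕ → List Bool) (T : ℝ) (F : Finset ℕ) : 0 ≤ tailMoment q T F :=
  tsum_nonneg fun i => by positivity

theorem specificHeat_pos (hc : IsCodeOf c U) (hq : Function.Injective q)
    (hqU : Set.range q = U.Dom) (hT : 0 < T) (hT1 : T < 1)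
    (hs : Summable fun i => (1 / 2 : ℝ) ^ (q i).length) : 0 < specificHeat q T := by
  obtain ⟨t₀, k, K, hk, hK, h⟩ := exists_finHeat_stage_bounds hc hq hqU hT hT1 hs
  obtain ⟨-, h1, h2, -⟩ := h t₀ le_rfl
  obtain ⟨i, hi⟩ := Infinite.exists_notMem_finset (stage c hq t₀)
  have h3 := le_tailMoment hT hT1 hs hi
  have h4 : (0 : ℝ) < (q i).length := by exact_mod_cast h1 i hi
  have h5 := finHeat_nonneg q T (stage c hq t₀)
  have h6 : 0 < k * tailMoment q T (stage c hq t₀) := mul_pos hk (lt_of_lt_of_le (by positivity) h3)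
  linarith

theorem isLeftComputable_specificHeat (hc : IsCodeOf c U) (hq : Function.Injective q)
    (hqU : Set.range q = U.Dom) (hT : 0 < T) (hT1 : T < 1) (hTc : IsComputableReal T)
    (hs : Summable fun i => (1 / 2 : ℝ) ^ (q i).length) : IsLeftComputable (specificHeat q T) := by
  refine IsLowerRE.isLeftComputable (specificHeat_pos hc hq hqU hT hT1 hs) ?_
  obtain ⟨t₀, k, K, hk, hK, h⟩ := exists_finHeat_stage_bounds hc hq hqU hT hT1 hs
  have hre : IsRE fun z : (ℕ × ℕ) × ℕ =>
      (z.1.1 : ℝ) < finHeat q T (stage c hq (z.2 + t₀)) * z.1.2 :=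
    (isRE_lt_finHeat_stage hc hq hqU hT hTc).comp
      (f := fun z : (ℕ × ℕ) × ℕ => (z.2 + t₀, z.1.1, z.1.2))
      (show Primrec fun z : (ℕ × ℕ) × ℕ => (z.2 + t₀, z.1.1, z.1.2) by fun_prop).to_comp
  refine hre.exists.of_iff fun ⟨u, d⟩ => ⟨fun hud => ?_, ?_⟩
  · have h1 := ((tendsto_add_atTop_iff_nat t₀).2
      (tendsto_finHeat_stage hc hq hqU hT hT1 hs)).mul_const (d : ℝ)
    exact (h1.eventually_const_lt hud).exists
  · rintro ⟨t, ht⟩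
    refine ht.trans_le (mul_le_mul_of_nonneg_right ?_ (Nat.cast_nonneg d))
    have h1 := (h (t + t₀) (Nat.le_add_left _ _)).2.2.1
    have h2 := mul_nonneg hk.le (tailMoment_nonneg q T (stage c hq (t + t₀)))
    linarith

end Stages

end AIT

/-! ### Randomness and compressibility of the specific heat -/

namespace AIT

open Nat.Partrec (Code)

section Randomness

variable {U : List Bool →. List Bool} {c : Code} {q : ℕ → List Bool} {T : ℝ}

/-! ### Randomness -/

theorem isComputer_bind {U : List Bool →. List Bool} (hU : IsComputer U)
    {f : List Bool →. List Bool} (hf : Partrec f) : IsComputer fun p => (U p).bind f := by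
  refine ⟨hU.1.bind (hf.comp Computable.snd).to₂, fun p hp p' hp' => hU.2 p ?_ p' ?_⟩
  · exact (Part.dom_iff_mem.1 hp).elim fun x hx =>
      Part.dom_iff_mem.2 ⟨_, (Part.mem_bind_iff.1 hx).choose_spec.1⟩
  · exact (Part.dom_iff_mem.1 hp').elim fun x hx =>
      Part.dom_iff_mem.2 ⟨_, (Part.mem_bind_iff.1 hx).choose_spec.1⟩

/-- A program for the first `n` bits of the specific heat can be turned into a program of almost
the same length for a string whose shortest program contributes at most `2 / 2 ^ n`. -/
theorem exists_short_program (hU : IsOptimal U) (hc : IsCodeOf c U) (hq : Function.Injective q)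
    (hqU : Set.range q = U.Dom) (hT : 0 < T) (hT1 : T < 1) (hTc : IsComputableReal T)
    (hs : Summable fun i => (1 / 2 : ℝ) ^ (q i).length) :
    ∃ (k : ℝ) (sim : ℕ), 0 < k ∧ ∀ n : ℕ, ∃ i,
      (q i).length ≤ complexity U (firstBits (specificHeat q T) n) + sim ∧ 1 ≤ (q i).length ∧
      k * (((q i).length : ℝ) ^ 2 * ((2 : ℝ) ^ (-(1 / T))) ^ (q i).length) < 2 / 2 ^ n := by
  set α := specificHeat q T with hα
  have hα0 : 0 < α := specificHeat_pos hc hq hqU hT hT1 hs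
  obtain ⟨t₀, k, K, hk, hK, hbd⟩ := exists_finHeat_stage_bounds hc hq hqU hT hT1 hs
  -- Subtracting one from the scaled floor makes the target strictly smaller than `α * 2 ^ n`, so
  -- some stage exceeds it. A zero floor means `α * 2 ^ n < 1`, and any stage will do.
  have hre : IsRE fun z : List Bool × ℕ => ⌊α⌋₊ * 2 ^ z.1.length + bitsValue z.1 < 1 ∨
      ((⌊α⌋₊ * 2 ^ z.1.length + bitsValue z.1 - 1 : ℕ) : ℝ) <
        finHeat q T (stage c hq (z.2 + t₀)) * (2 ^ z.1.length : ℕ) :=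
    (IsRE.natLt (by fun_prop) (by fun_prop)).or ((isRE_lt_finHeat_stage hc hq hqU hT hTc).comp
      (f := fun z : List Bool × ℕ => (z.2 + t₀, ⌊α⌋₊ * 2 ^ z.1.length + bitsValue z.1 - 1,
        2 ^ z.1.length)) (Primrec.to_comp (by fun_prop)))
  obtain ⟨f, hf, hf1, hf2⟩ := hre.exists_select
  have hfresh : Partrec fun s => (f s).map fun t => freshString c (t + t₀) :=
    hf.map ((primrec_freshString c).to_comp.comp
      (Primrec.to_comp (f := fun z : List Bool × ℕ => z.2 + t₀) (by fun_prop))).to₂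
  obtain ⟨sim, hsim⟩ := hU.2 _ (isComputer_bind hU.1 hfresh)
  refine ⟨k, sim, hk, fun n => ?_⟩
  set s := firstBits α n with hsdef
  have hX : ⌊α⌋₊ * 2 ^ s.length + bitsValue s = ⌊α * 2 ^ n⌋₊ := by
    rw [length_firstBits, floor_eq_bitsValue_firstBits hα0.le]
  have hlen : s.length = n := length_firstBits _ _
  have hpow : (0 : ℝ) < 2 ^ n := by positivity
  have hfl : (⌊α * 2 ^ n⌋₊ : ℝ) ≤ α * 2 ^ n := Nat.floor_le (by positivity)
  have hlim := ((tendsto_add_atTop_iff_nat t₀).2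
    (tendsto_finHeat_stage hc hq hqU hT hT1 hs)).mul_const (2 ^ n : ℝ)
  have hdom : (f s).Dom := by
    rcases Nat.eq_zero_or_pos ⌊α * 2 ^ n⌋₊ with h0 | h0
    · exact hf2 s 0 (Or.inl (by dsimp only; omega))
    · have h1 : ((⌊α * 2 ^ n⌋₊ - 1 : ℕ) : ℝ) < α * 2 ^ n := by
        rw [Nat.cast_sub h0]; push_cast; linarith
      obtain ⟨t, ht⟩ := (hlim.eventually_const_lt h1).exists
      refine hf2 s t (Or.inr ?_)
      dsimp only
      rw [hX, hlen]
      push_cast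
      exact ht
  obtain ⟨t, ht⟩ := Part.dom_iff_mem.1 hdom
  have hclose : α - finHeat q T (stage c hq (t + t₀)) < 2 / 2 ^ n := by
    rw [lt_div_iff₀ hpow, sub_mul]
    have h1 : α * 2 ^ n < ⌊α * 2 ^ n⌋₊ + 1 := Nat.lt_floor_add_one _
    rcases hf1 s t ht with h2 | h2
    · dsimp only at h2
      rw [hX] at h2
      have h3 : ⌊α * 2 ^ n⌋₊ = 0 := by omega
      have h4 := mul_nonneg (finHeat_nonneg q T (stage c hq (t + t₀))) hpow.le
      rw [h3] at h1
      push_cast at h1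
      linarith
    · dsimp only at h2
      rw [hX, hlen] at h2
      have h3 : (⌊α * 2 ^ n⌋₊ : ℝ) - 1 ≤ ((⌊α * 2 ^ n⌋₊ - 1 : ℕ) : ℝ) := by
        have : ⌊α * 2 ^ n⌋₊ ≤ (⌊α * 2 ^ n⌋₊ - 1) + 1 := by omega
        have : (⌊α * 2 ^ n⌋₊ : ℝ) ≤ ((⌊α * 2 ^ n⌋₊ - 1 : ℕ) : ℝ) + 1 := by exact_mod_cast this
        linarith
      push_cast at h2
      linarith
  obtain ⟨p, hp, hplen⟩ := hU.exists_program s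
  obtain ⟨p', hp', hp'len⟩ := hsim p (freshString c (t + t₀))
    (Part.mem_bind_iff.2 ⟨s, hp, Part.mem_map _ ht⟩)
  have : p' ∈ Set.range q := hqU ▸ Part.dom_iff_mem.2 ⟨_, hp'⟩
  obtain ⟨i, rfl⟩ := this
  -- The program found is outside the stage, so its term is part of a tail already known to be below
  -- `2 / 2 ^ n` up to the factor `k`.
  have hi : i ∉ stage c hq (t + t₀) := fun hi => freshString_notMem hc hi hp'
  obtain ⟨-, h1, h2, -⟩ := hbd (t + t₀) (Nat.le_add_left _ _)
  refine ⟨i, by rw [← hplen]; exact hp'len, h1 i hi, ?_⟩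
  have h3 := mul_le_mul_of_nonneg_left (le_tailMoment hT hT1 hs hi) hk.le
  linarith

/-- Taking logarithms gives `L ≥ T * n + 2 * T * log L - T * A`. Dropping the logarithm shows that
`L` grows linearly; inserting this back makes the logarithmic term tend to infinity, and `L` exceeds
the complexity by at most `sim`. -/
theorem isChaitinRandom_specificHeat (hU : IsOptimal U) (hc : IsCodeOf c U)
    (hq : Function.Injective q) (hqU : Set.range q = U.Dom) (hT : 0 < T) (hT1 : T < 1)
    (hTc : IsComputableReal T) (hs : Summable fun i => (1 / 2 : ℝ) ^ (q i).length) :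
    IsChaitinRandom U T (specificHeat q T) := by
  obtain ⟨k, sim, hk, h⟩ := exists_short_program hU hc hq hqU hT hT1 hTc hs
  set A := Real.logb 2 (2 / k) with hA
  have hlim : Tendsto (fun n : ℕ => T * (2 * Real.logb 2 (T * n + -(T * A))) + -(T * A + sim)) atTop atTop := by
    refine tendsto_atTop_add_const_right _ _ (Tendsto.const_mul_atTop hT
      (Tendsto.const_mul_atTop two_pos ?_))
    exact (Real.tendsto_logb_atTop (by norm_num)).comp (tendsto_atTop_add_const_right _ _
      (tendsto_natCast_atTop_atTop.const_mul_atTop hT))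
  refine tendsto_atTop_mono' _ ?_ hlim
  have hev : ∀ᶠ n : ℕ in atTop, 0 < T * n + -(T * A) :=
    (tendsto_atTop_add_const_right _ _
      (tendsto_natCast_atTop_atTop.const_mul_atTop hT)).eventually_gt_atTop 0
  filter_upwards [hev] with n hn
  obtain ⟨i, hi1, hi2, hi3⟩ := h n
  set L : ℝ := ((q i).length : ℝ) with hL
  have hL1 : 1 ≤ L := Nat.one_le_cast.2 hi2
  have hLH : L ≤ complexity U (firstBits (specificHeat q T) n) + sim := by
    rw [hL]; exact_mod_cast hi1
  have h1 : L ^ 2 * ((2 : ℝ) ^ (-(1 / T))) ^ (q i).length < 2 / k / 2 ^ n := by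
    rw [div_right_comm, lt_div_iff₀ hk, mul_comm]
    exact hi3
  have h2 := Real.logb_lt_logb (b := 2) (by norm_num) (by positivity) h1
  rw [Real.logb_mul (by positivity) (by positivity), Real.logb_div (by positivity) (by positivity),
    Real.logb_pow, Real.logb_pow, Real.logb_pow, Real.logb_rpow (by norm_num) (by norm_num),
    Real.logb_self_eq_one (by norm_num), ← hL] at h2
  push_cast at h2
  have hlog : 0 ≤ Real.logb 2 L := Real.logb_nonneg (by norm_num) hL1
  have h3 : T * (2 * Real.logb 2 L) + T * n - T * A ≤ L := by
    have h4 : 2 * Real.logb 2 L + n - A ≤ L / T := by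
      have : L * (-(1 / T)) = -(L / T) := by ring
      rw [this] at h2
      linarith
    rw [le_div_iff₀ hT] at h4
    linarith
  have h5 : T * n + -(T * A) ≤ L := by
    have := mul_nonneg hT.le (mul_nonneg zero_le_two hlog)
    linarith
  have h6 : Real.logb 2 (T * n + -(T * A)) ≤ Real.logb 2 L :=
    Real.logb_le_logb_of_le (by norm_num) hn h5
  have h7 : T * (2 * Real.logb 2 (T * n + -(T * A))) ≤ T * (2 * Real.logb 2 L) := by gcongr
  linarith

/-! ### Compressibility -/

theorem isComputer_headerCode {h : ℕ → ℕ} {f : List Bool →. List Bool} (hf : Partrec f)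
    (hdom : ∀ p ∈ f.Dom, IsHeaderCode h p) : IsComputer f :=
  ⟨hf, fun p hp p' hp' => (hdom p hp).eq_of_prefix (hdom p' hp')⟩

/-- Compressing the first `J * m + r` bits of the specific heat. -/
theorem exists_compressor (hU : IsOptimal U) (hc : IsCodeOf c U) (hq : Function.Injective q)
    (hqU : Set.range q = U.Dom) (hT : 0 < T) (hT1 : T < 1) (hTc : IsComputableReal T)
    (hs : Summable fun i => (1 / 2 : ℝ) ^ (q i).length)
    (hs1 : ∑' i, (1 / 2 : ℝ) ^ (q i).length ≤ 1) {J K : ℕ} (hJK : T * J + 1 ≤ K) (r : ℕ)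
    (hr : r < J) :
    ∃ M : ℕ, ∀ᶠ m : ℕ in atTop, complexity U (firstBits (specificHeat q T) (J * m + r)) ≤
      m + 1 + K * (m + 1) + M := by
  set α := specificHeat q T with hα
  have hα0 : 0 < α := specificHeat_pos hc hq hqU hT hT1 hs
  obtain ⟨t₀, k, C, hk, hC, hbd⟩ := exists_finHeat_stage_bounds hc hq hqU hT hT1 hs
  set h : ℕ → ℕ := fun m => K * (m + 1) with hh
  have hh' : Primrec h := by fun_prop
  set b := (2 : ℝ) ^ (-(1 / T)) with hb
  have hb0 : 0 < b := two_rpow_neg_inv_pos T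
  obtain ⟨C', hC', htail⟩ := exists_tail_moment_le hs hb0 (two_rpow_neg_inv_lt_half hT hT1)
  -- The header of the string `z.1` is `m` and its body an approximation to the halting probability.
  -- The search asks for a stage `z.2.1` whose weight exceeds it, and for an integer `z.2.2` within
  -- two below the scaled heat of that stage; the slack allows strict, hence enumerable,
  -- comparisons.
  have hre : IsRE fun z : List Bool × ℕ × ℕ => ((IsHeaderCode h z.1 ∧
      (bitsValue z.1 - 2 ^ (h (z.1.idxOf true))) * 2 ^ (z.2.1 + t₀) <
        2 ^ (h (z.1.idxOf true)) * stageMoment c 0 (z.2.1 + t₀) 1 2) ∧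
      (z.2.2 < 1 ∨ (z.2.2 : ℝ) < finHeat q T (stage c hq (z.2.1 + t₀)) *
        (2 ^ (J * z.1.idxOf true + r) : ℕ))) ∧ ((stage c hq (z.2.1 + t₀)).Nonempty ∧
      finHeat q T (stage c hq (z.2.1 + t₀)) * (2 ^ (J * z.1.idxOf true + r) : ℕ) <
        (z.2.2 + 2 : ℕ)) :=
    (((IsRE.of_primrecPred ((primrecPred_isHeaderCode hh').comp Primrec.fst)).and
      (IsRE.natLt (by fun_prop) (by fun_prop))).and ((IsRE.natLt (by fun_prop) (by fun_prop)).or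
      ((isRE_lt_finHeat_stage hc hq hqU hT hTc).comp (f := fun z : List Bool × ℕ × ℕ =>
        (z.2.1 + t₀, z.2.2, 2 ^ (J * z.1.idxOf true + r))) (Primrec.to_comp (by fun_prop))))).and
      ((isRE_finHeat_stage_lt hc hq hqU hT hTc).comp (f := fun z : List Bool × ℕ × ℕ =>
        (z.2.1 + t₀, z.2.2 + 2, 2 ^ (J * z.1.idxOf true + r))) (Primrec.to_comp (by fun_prop)))
  obtain ⟨f, hf, hf1, hf2⟩ := hre.exists_select
  have hcomp : ∀ β : ℕ, IsComputer fun p =>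
      (f p).map fun w => bitList (J * p.idxOf true + r) (w.2 + β) := by
    intro β
    refine isComputer_headerCode (h := h) (hf.map (primrec_bitList.to_comp.comp (Primrec.to_comp
      (f := fun z : List Bool × ℕ × ℕ => (J * z.1.idxOf true + r, z.2.2 + β))
      (by fun_prop))).to₂) fun p hp => ?_
    obtain ⟨x, hx⟩ := Part.dom_iff_mem.1 hp
    obtain ⟨w, hw, -⟩ := (Part.mem_map_iff _).1 hx
    exact (hf1 p w hw).1.1.1
  choose sim hsim using fun β => hU.2 _ (hcomp β)
  refine ⟨sim 0 + sim 1 + sim 2, ?_⟩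
  -- Since `T < 1`, the bound `T * J + 1 ≤ K` gives `J + 1 ≤ K / T`. The spare factor `1 / 2` per
  -- block absorbs the polynomial factor of the tail estimate.
  have hbK : b ^ K ≤ (1 / 2) ^ (J + 1) := by
    have h1 : (1 / 2 : ℝ) ^ (J + 1) = (2 : ℝ) ^ (-((J : ℝ) + 1)) := by
      rw [Real.rpow_neg (by norm_num), one_div, inv_pow]
      congr 1
      exact_mod_cast (Real.rpow_natCast 2 (J + 1)).symm
    rw [h1, hb, ← Real.rpow_mul_natCast (by norm_num)]
    refine Real.rpow_le_rpow_of_exponent_le (by norm_num) ?_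
    have h2 : (J : ℝ) + 1 ≤ K / T := by
      rw [le_div_iff₀ hT]
      linarith
    have h3 : -(1 / T) * K = -(K / T) := by ring
    linarith
  have hsmall : ∀ᶠ m : ℕ in atTop,
      C * C' * K ^ 2 * (((m + 1 : ℕ) : ℝ) ^ 2 * (1 / 2) ^ (m + 1)) ≤ 1 := by
    have h1 := ((tendsto_pow_const_mul_const_pow_of_lt_one 2 (r := (1 / 2 : ℝ)) (by norm_num)
      (by norm_num)).comp (tendsto_add_atTop_nat 1)).const_mul (C * C' * (K : ℝ) ^ 2)
    rw [mul_zero] at h1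
    exact (h1.eventually_lt_const one_pos).mono fun m hm => hm.le
  filter_upwards [hsmall] with m hm
  set n := J * m + r with hn
  set Ω := ∑' i, (1 / 2 : ℝ) ^ (q i).length with hΩ
  have hΩ0 : 0 < Ω := hs.tsum_pos (fun i => by positivity) 0 (by positivity)
  have hKpos : 0 < K := by
    have : (0 : ℝ) < K := by
      have : 0 ≤ T * J := by positivity
      linarith
    exact_mod_cast this
  have hkpos : 0 < h m := Nat.mul_pos hKpos (Nat.succ_pos m)
  have h2k : (0 : ℝ) < 2 ^ h m := by positivity
  -- This is the largest integer strictly below `Ω * 2 ^ h m`: strictness lets a finite stage exceed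
  -- it, and `Ω ≤ 1` makes it fit into `h m` bits.
  set a := ⌈Ω * 2 ^ h m⌉₊ - 1 with ha
  have hceil : 0 < ⌈Ω * 2 ^ h m⌉₊ := Nat.ceil_pos.2 (by positivity)
  have hacast : (a : ℝ) = ⌈Ω * 2 ^ h m⌉₊ - 1 := by rw [ha, Nat.cast_sub hceil]; simp
  have ha1 : (a : ℝ) < Ω * 2 ^ h m := by
    have := Nat.ceil_lt_add_one (show 0 ≤ Ω * 2 ^ h m by positivity)
    linarith
  have ha2 : Ω * 2 ^ h m ≤ a + 1 := by
    have := Nat.le_ceil (Ω * 2 ^ h m)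
    linarith
  have ha3 : a < 2 ^ h m := by
    have : (a : ℝ) < 2 ^ h m := ha1.trans_le (mul_le_of_le_one_left h2k.le hs1)
    exact_mod_cast this
  set p := List.replicate m false ++ true :: bitList (h m) a with hp
  have hpidx : p.idxOf true = m := idxOf_true_header _ _
  have hpcode : IsHeaderCode h p := isHeaderCode_header (length_bitList _ _)
  have hpval : bitsValue p - 2 ^ h m = a := by
    rw [hp, bitsValue_header, length_bitList, bitsValue_bitList, Nat.mod_eq_of_lt ha3]
    omega
  have hS : ∀ t, (stageMoment c 0 t 1 2 : ℝ) = 2 ^ t * ∑ i ∈ stage c hq t, (1 / 2 : ℝ) ^ (q i).length := by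
    intro t
    rw [stageMoment_cast hc hq hqU _ _ _ two_pos]
    simp
  have hpn : (0 : ℝ) < 2 ^ n := by positivity
  have hdom : (f p).Dom := by
    have h1 : Tendsto (fun t => (∑ i ∈ stage c hq (t + t₀), (1 / 2 : ℝ) ^ (q i).length) * 2 ^ h m) atTop
        (𝓝 (Ω * 2 ^ h m)) :=
      ((tendsto_add_atTop_iff_nat t₀).2 (hs.hasSum.comp (tendsto_stage hc hq hqU))).mul_const _
    obtain ⟨t, ht⟩ := (h1.eventually_const_lt ha1).exists
    set X := finHeat q T (stage c hq (t + t₀)) * 2 ^ n with hX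
    refine hf2 p (t, ⌈X⌉₊ - 1) ⟨⟨⟨hpcode, ?_⟩, ?_⟩, ⟨(hbd (t + t₀) (Nat.le_add_left _ _)).1, ?_⟩⟩
    · dsimp only
      rw [hpidx, hpval, ← Nat.cast_lt (α := ℝ)]
      push_cast
      rw [hS]
      have := mul_lt_mul_of_pos_left ht (show (0 : ℝ) < 2 ^ (t + t₀) by positivity)
      linarith
    · dsimp only
      rw [hpidx, ← hn]
      push_cast
      rw [← hX]
      rcases Nat.eq_zero_or_pos ⌈X⌉₊ with h0 | h0
      · left; omega
      · right
        rw [Nat.cast_sub h0]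
        have := Nat.ceil_lt_add_one (show 0 ≤ X from (Nat.ceil_pos.1 h0).le)
        push_cast
        linarith
    · dsimp only
      rw [hpidx, ← hn]
      push_cast
      rw [← hX]
      have h2 := Nat.le_ceil X
      have h3 : (⌈X⌉₊ : ℝ) ≤ ((⌈X⌉₊ - 1 : ℕ) : ℝ) + 1 := by
        have : ⌈X⌉₊ ≤ (⌈X⌉₊ - 1) + 1 := by omega
        exact_mod_cast this
      linarith
  obtain ⟨⟨t, z⟩, hw⟩ := Part.dom_iff_mem.1 hdom
  obtain ⟨⟨⟨-, w1⟩, w2⟩, ⟨-, w3⟩⟩ := hf1 p _ hw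
  dsimp only at w1 w2 w3
  rw [hpidx, hpval, ← Nat.cast_lt (α := ℝ)] at w1
  rw [hpidx, ← hn] at w2 w3
  push_cast at w1 w2 w3
  rw [hS] at w1
  set F := stage c hq (t + t₀) with hF
  have w1' : (a : ℝ) < 2 ^ h m * ∑ i ∈ F, (1 / 2 : ℝ) ^ (q i).length := by
    refine lt_of_mul_lt_mul_right ?_ (show (0 : ℝ) ≤ 2 ^ (t + t₀) by positivity)
    linarith
  have htl : (∑' i : {i // i ∉ F}, (1 / 2 : ℝ) ^ (q i).length) ≤ (1 / 2) ^ h m := by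
    have h1 := hs.sum_add_tsum_subtype_compl F
    have h3 : (1 / 2 : ℝ) ^ h m = 1 / 2 ^ h m := one_div_pow 2 _
    rw [h3, le_div_iff₀ h2k]
    have h2 : (∑' i : {i // i ∉ F}, (1 / 2 : ℝ) ^ (q i).length) =
        Ω - ∑ i ∈ F, (1 / 2 : ℝ) ^ (q i).length := by linarith
    rw [h2, sub_mul]
    linarith
  obtain ⟨-, -, hb1, hb2⟩ := hbd (t + t₀) (Nat.le_add_left _ _)
  have htm : C * tailMoment q T F * 2 ^ n ≤ 1 := by
    have h1 : tailMoment q T F ≤ C' * (h m : ℝ) ^ 2 * b ^ h m := htail F (h m) hkpos htl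
    have h2 : b ^ h m ≤ (1 / 2) ^ n * (1 / 2) ^ (m + 1) := by
      calc b ^ h m = (b ^ K) ^ (m + 1) := by rw [← pow_mul]
        _ ≤ ((1 / 2) ^ (J + 1)) ^ (m + 1) := by gcongr
        _ = (1 / 2) ^ (J * (m + 1)) * (1 / 2) ^ (m + 1) := by rw [← pow_mul, ← pow_add]; ring_nf
        _ ≤ (1 / 2) ^ n * (1 / 2) ^ (m + 1) := by
          refine mul_le_mul_of_nonneg_right ?_ (by positivity)
          refine pow_le_pow_of_le_one (by norm_num) (by norm_num) ?_
          rw [hn, Nat.mul_succ]; omega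
    calc C * tailMoment q T F * 2 ^ n
        ≤ C * (C' * (h m : ℝ) ^ 2 * ((1 / 2) ^ n * (1 / 2) ^ (m + 1))) * 2 ^ n := by
          gcongr
          exact h1.trans (by gcongr)
      _ = C * C' * K ^ 2 * (((m + 1 : ℕ) : ℝ) ^ 2 * (1 / 2) ^ (m + 1)) * ((1 / 2) * 2) ^ n := by
          rw [hh, mul_pow (1 / 2 : ℝ) 2 n]; push_cast; ring
      _ ≤ 1 := by
          rw [show (1 / 2 : ℝ) * 2 = 1 by norm_num, one_pow, mul_one]; exact hm
  have hup : α * 2 ^ n ≤ finHeat q T F * 2 ^ n + 1 := by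
    have := mul_le_mul_of_nonneg_right hb2 hpn.le
    linarith
  have hlow : finHeat q T F * 2 ^ n ≤ α * 2 ^ n := by
    refine mul_le_mul_of_nonneg_right ?_ hpn.le
    have := mul_nonneg hk.le (tailMoment_nonneg q T F)
    linarith
  have hz1 : z ≤ ⌊α * 2 ^ n⌋₊ := by
    rcases w2 with h0 | h0
    · omega
    · exact Nat.le_floor (h0.le.trans hlow)
  have hz2 : ⌊α * 2 ^ n⌋₊ < z + 3 := by
    rw [Nat.floor_lt (by positivity)]
    push_cast
    linarith
  -- The error of `z` is `0`, `1` or `2`; each value has its own machine, so the correction costs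
  -- only a constant.
  set β := ⌊α * 2 ^ n⌋₊ - z with hβ
  have hβ3 : β < 3 := by omega
  have hmem : firstBits α n ∈ (f p).map fun w => bitList (J * p.idxOf true + r) (w.2 + β) := by
    refine (Part.mem_map_iff _).2 ⟨_, hw, ?_⟩
    dsimp only
    rw [hpidx, ← hn, firstBits_eq_bitList hα0.le]
    congr 1
    omega
  obtain ⟨p', hp', hp'len⟩ := hsim β p _ hmem
  have hplen : p.length = m + 1 + h m := by rw [hpcode, hpidx]
  have hsimle : sim β ≤ sim 0 + sim 1 + sim 2 := by
    interval_cases β <;> omega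
  have hhm : h m = K * (m + 1) := rfl
  have := complexity_le hp'
  omega

/-- Blocks of `J` bits cost at most `K + 1 ≤ T * J + 3` program bits each, a rate of `T + 3 / J`.
Every remainder modulo `J` has its own constant, and `J` is arbitrary. -/
theorem isCompressible_specificHeat (hU : IsOptimal U) (hc : IsCodeOf c U)
    (hq : Function.Injective q) (hqU : Set.range q = U.Dom) (hT : 0 < T) (hT1 : T < 1)
    (hTc : IsComputableReal T) (hs : Summable fun i => (1 / 2 : ℝ) ^ (q i).length)
    (hs1 : ∑' i, (1 / 2 : ℝ) ^ (q i).length ≤ 1) :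
    IsCompressible U T (specificHeat q T) := by
  set H : ℕ → ℝ := fun n => (complexity U (firstBits (specificHeat q T) n) : ℝ) with hH
  have key : ∀ ε : ℝ, 0 < ε → ∀ᶠ n : ℕ in atTop, H n ≤ T * n + ε * n := by
    intro ε hε
    -- This makes `3 / J` at most `ε / 2`; the other half of `ε` absorbs the constants collected in
    -- `D`.
    obtain ⟨J, hJ⟩ := exists_nat_gt (6 / ε)
    have hJ0 : (0 : ℝ) < J := lt_trans (by positivity) hJ
    have hJ0' : 0 < J := by exact_mod_cast hJ0
    set K := ⌈T * J⌉₊ + 1 with hK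
    have hK1 : T * J + 1 ≤ K := by
      rw [hK]; push_cast; linarith [Nat.le_ceil (T * J)]
    have hK2 : (K : ℝ) ≤ T * J + 2 := by
      rw [hK]; push_cast; linarith [Nat.ceil_lt_add_one (show 0 ≤ T * J by positivity)]
    have hM : ∀ r : ℕ, ∃ M : ℕ, r < J → ∀ᶠ m : ℕ in atTop,
        complexity U (firstBits (specificHeat q T) (J * m + r)) ≤ m + 1 + K * (m + 1) + M := by
      intro r
      by_cases hr : r < J
      · obtain ⟨M, hM⟩ := exists_compressor hU hc hq hqU hT hT1 hTc hs hs1 hK1 r hr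
        exact ⟨M, fun _ => hM⟩
      · exact ⟨0, fun h => absurd h hr⟩
    choose M hM using hM
    have hall : ∀ᶠ m : ℕ in atTop, ∀ r ∈ Finset.range J,
        complexity U (firstBits (specificHeat q T) (J * m + r)) ≤ m + 1 + K * (m + 1) + M r :=
      (Filter.eventually_all_finset _).2 fun r hr => hM r (Finset.mem_range.1 hr)
    have hdiv : Tendsto (fun n : ℕ => n / J) atTop atTop := Nat.tendsto_div_const_atTop hJ0'.ne'
    set D : ℝ := T * J + 3 + ∑ r ∈ Finset.range J, (M r : ℝ) with hD
    have hlarge : ∀ᶠ n : ℕ in atTop, D ≤ ε / 2 * n :=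
      (tendsto_natCast_atTop_atTop.const_mul_atTop (half_pos hε)).eventually_ge_atTop D
    filter_upwards [hdiv.eventually hall, hlarge] with n hn1 hn2
    have hmod : n % J < J := Nat.mod_lt _ hJ0'
    have h1 := hn1 (n % J) (Finset.mem_range.2 hmod)
    rw [Nat.div_add_mod] at h1
    have h2 : H n ≤ ((n / J : ℕ) : ℝ) + 1 + K * (((n / J : ℕ) : ℝ) + 1) + M (n % J) := by
      simp only [hH]; exact_mod_cast h1
    have h3 : (M (n % J) : ℝ) ≤ ∑ r ∈ Finset.range J, (M r : ℝ) :=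
      Finset.single_le_sum (f := fun r => (M r : ℝ)) (fun _ _ => Nat.cast_nonneg _)
        (Finset.mem_range.2 hmod)
    have h4 : ((n / J : ℕ) : ℝ) ≤ n / J := Nat.cast_div_le
    have h5 : (T * J + 3) * ((n / J : ℕ) : ℝ) ≤ T * n + ε / 2 * n := by
      calc (T * J + 3) * ((n / J : ℕ) : ℝ) ≤ (T * J + 3) * (n / J) := by gcongr
        _ = T * n + 3 / J * n := by field_simp
        _ ≤ T * n + ε / 2 * n := by
          have : 3 / (J : ℝ) ≤ ε / 2 := by
            rw [div_lt_iff₀ hε] at hJ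
            rw [div_le_div_iff₀ hJ0 two_pos]
            linarith
          gcongr
    have h6 : (K + 1) * (((n / J : ℕ) : ℝ) + 1) ≤ (T * J + 3) * (((n / J : ℕ) : ℝ) + 1) := by
      refine mul_le_mul_of_nonneg_right (by linarith) (by positivity)
    linarith
  refine ⟨fun n => max (H n - T * n) 0, ?_, fun n _ => ?_⟩
  · refine tendsto_order.2 ⟨fun y hy => .of_forall fun n => hy.trans_le (by positivity),
      fun y hy => ?_⟩
    filter_upwards [key (y / 2) (half_pos hy), eventually_gt_atTop 0] with n hn hn0
    have hn0' : (0 : ℝ) < n := by exact_mod_cast hn0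
    rw [div_lt_iff₀ hn0']
    have h1 : y / 2 * n < y * n := mul_lt_mul_of_pos_right (half_lt_self hy) hn0'
    exact max_lt (by linarith) (by positivity)
  · have := le_max_left (H n - T * n) 0
    simp only [hH] at this ⊢
    linarith

end Randomness

end AIT

theorem theorem4p5 (U : List Bool →. List Bool) (hU : AIT.IsOptimal U)
    (q : ℕ → List Bool) (hq_inj : Function.Injective q) (hq_range : Set.range q = U.Dom) :
    (∀ (n : ℕ) (T : ℝ), 0 < T → DifferentiableAt ℝ (AIT.energyN q n) T) ∧
    (∀ T : ℝ, 0 < T → T < 1 → AIT.IsComputableReal T →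
      Tendsto (fun n => AIT.specificHeatN q n T) atTop (𝓝 (AIT.specificHeat q T)) ∧
      AIT.IsLeftComputable (AIT.specificHeat q T) ∧
      AIT.IsChaitinRandom U T (AIT.specificHeat q T) ∧
      AIT.IsCompressible U T (AIT.specificHeat q T) ∧
      (∀ t ∈ Set.Ioo (0 : ℝ) 1,
        Tendsto (fun n => AIT.energyN q n t) atTop (𝓝 (AIT.energy q t))) ∧
      HasDerivAt (AIT.energy q) (AIT.specificHeat q T) T) ∧
    Tendsto (fun n => AIT.specificHeatN q n 1) atTop atTop := by
  have hqU : ∀ i, q i ∈ U.Dom := fun i => hq_range ▸ Set.mem_range_self i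
  have hs := AIT.summable_half_pow_length hU.1.2 hq_inj hqU
  have hs1 : ∑' i, (1 / 2 : ℝ) ^ (q i).length ≤ 1 :=
    hs.tsum_le_of_sum_le (AIT.sum_half_pow_length_le_one hU.1.2 hq_inj hqU)
  obtain ⟨c, hc⟩ := AIT.exists_isCodeOf hU.1.1
  refine ⟨fun n T hT => (AIT.hasDerivAt_energyN q n hT).differentiableAt,
    fun T hT hT1 hTc => ⟨?_, ?_, ?_, ?_, ?_, ?_⟩, AIT.tendsto_specificHeatN_one hU hq_range hs⟩
  · have h := AIT.tendsto_specificHeatN hs hT hT1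
    rwa [← AIT.specificHeat_eq hs hT hT1] at h
  · exact AIT.isLeftComputable_specificHeat hc hq_inj hq_range hT hT1 hTc hs
  · exact AIT.isChaitinRandom_specificHeat hU hc hq_inj hq_range hT hT1 hTc hs
  · exact AIT.isCompressible_specificHeat hU hc hq_inj hq_range hT hT1 hTc hs hs1
  · intro t ht
    have h := AIT.tendsto_energyN hs ht.1 ht.2
    rwa [← AIT.energy_eq hs ht.1 ht.2] at h
  · exact AIT.hasDerivAt_energy hs hT hT1
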